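/- **Setting.** Consider a mixture of $P$ polyatomic gases with masses $m_1,\dots,m_P>0$, total mass $\mathrm m=\sum_\ell m_\ell$, and exponents $\alpha_1,\dots,\alpha_P>-1$. Fix $i,j\in\{1,\dots,P\}$ and put $\mu_{ij}=\frac{m_im_j}{m_i+m_j}$ and $\bar s_{ij}=\min\{\frac{m_i}{m_i+m_j},\frac{m_j}{m_i+m_j}\}$. For $(v,I),(v_*,I_*)\in\mathbb R^3\times[0,\infty)$ let $u=v-v_*$, $\hat u=u/|u|$, $V_{ij}=\frac{m_iv+m_jv_*}{m_i+m_j}$ and $E_{ij}=\frac{\mu_{ij}}2|u|^2+I+I_*$. For $\sigma\in\mathbb S^2$ and $r,R\in[0,1]$ let $$v'=V_{ij}+\tfrac{m_j}{m_i+m_j}\sqrt{\tfrac{2RE_{ij}}{\mu_{ij}}}\,\sigma,\quad v'_*=V_{ij}-\tfrac{m_i}{m_i+m_j}\sqrt{\tfrac{2RE_{ij}}{\mu_{ij}}}\,\sigma,\quad I'=r(1-R)E_{ij},\quad I'_*=(1-r)(1-R)E_{ij},$$ $\sigma'=\hat u$, $R'=\frac{\mu_{ij}|u|^2}{2E_{ij}}$,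 $r'=\frac{I}{I+I_*}$, and $d_{ij}(r,R)=r^{\alpha_i}(1-r)^{\alpha_j}(1-R)^{\alpha_i+\alpha_j+1}\sqrt R$. The gain operator is $$Q^+_{ij}(f,g)(v,I)=\int_{\mathbb R^3\times[0,\infty)}\int_{\mathbb S^2\times[0,1]^2} f(v',I')\,g(v'_*,I'_*)\Big(\frac I{I'}\Big)^{\alpha_i}\Big(\frac{I_*}{I'_*}\Big)^{\alpha_j}\mathcal B_{ij}\,d_{ij}(r,R)\,d\sigma\,dr\,dR\,dv_*\,dI_* .$$ Let $\langle v,I\rangle_i=\sqrt{1+\frac{m_i}{2\mathrm m}|v|^2+\frac1{\mathrm m}I}$ and $\|h\|_{L^p_{i,k}}=\|h\,\langle\cdot\rangle_i^k\|_{L^p(\mathbb R^3\times[0,\infty),\,dv\,dI)}\in[0,\infty]$ for $1\le p\le\infty$. **Assumptions on the kernel.** Let $\gamma_{ij}\in[0,2]$, let $b_{ij}\ge0$ be integrable on $[-1,1]$, and let $\tilde b^{ub}_{ij}\ge0$ satisfy $\tilde b_{ij}^{ub}\in L^1([0,1]^2;d_{ij}\,dr\,dR)$. The measurable kernel $\mathcal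 B_{ij}=\mathcal B_{ij}(v,v_*,I,I_*,\sigma,r,R)\ge0$ satisfies, for almost all arguments, $$\mathcal B_{ij}(v,v_*,I,I_*,\sigma,r,R)\le b_{ij}(\hat u\cdot\sigma)\,\tilde b^{ub}_{ij}(r,R)\,(E_{ij}/\mathrm m)^{\gamma_{ij}/2},\qquad \mathcal B_{ij}(v,v_*,I,I_*,\sigma,r,R)=\mathcal B_{ij}(v',v'_*,I',I'_*,\sigma',r',R').$$ Write $b^+_{ij}(x)=b_{ij}(x)\mathbf 1_{x\ge0}$, $b^-_{ij}(x)=b_{ij}(x)\mathbf 1_{x\le0}$ and $\|b^\pm_{ij}\|_{L^1}=2\pi\int_{-1}^1b^\pm_{ij}(x)\,dx$. **Statement.** Let $p,q\in[1,\infty]$ with $\frac1p+\frac1q=1$ (and $\frac1\infty=0$) be such that $$\rho_{ij}(q)=\int_{[0,1]^2}r^{-(1+\frac{\gamma_{ij}}2)\frac1q}(1-R)^{-\frac1q}\,d_{ij}(r,R)\,\tilde b^{ub}_{ij}(r,R)\,dr\,dR<\infty,$$ let $k\ge0$, let $f,g,\chi$ be measurable real-valued functions on $\mathbb R^3\times[0,\infty)$,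 and put $$c_{ij}(q)=2^{\frac{\gamma_{ij}}{2q}}\,\bar s_{ij}^{\,-\frac{3+\gamma_{ij}}q}\,\rho_{ij}(q),$$ $$\mathcal M=2^{\frac1{2q}}c_{ij}(q)\Big(\|b^+_{ij}\|_{L^1}\|f\|_{L^p_{i,(k+\gamma_{ij})/p}}\|g\|_{L^1_{j,k/p+\gamma_{ij}}}+\|b^-_{ij}\|_{L^1}\|f\|_{L^1_{i,k/p+\gamma_{ij}}}\|g\|_{L^p_{j,(k+\gamma_{ij})/p}}\Big)\|\chi\|_{L^q_{i,(k+\gamma_{ij})/q}}$$ (with $0\cdot\infty=0$). If $\mathcal M<\infty$, then the integral defining $Q^+_{ij}(f,g)(v,I)$ converges absolutely for almost every $(v,I)$ with $\chi(v,I)\ne0$, the function $Q^+_{ij}(f,g)\,\chi\,\langle\cdot\rangle_i^k$ is integrable, and $$\int_{\mathbb R^3\times[0,\infty)}Q^+_{ij}(f,g)(v,I)\,\chi(v,I)\,\langle v,I\rangle_i^k\,dv\,dI\le\mathcal M .$$ -/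

import Mathlib

open MeasureTheory Set
open scoped ENNReal

noncomputable section

/-- Velocities: `ℝ³` with the Euclidean norm. -/
abbrev Vel : Type := EuclideanSpace ℝ (Fin 3)

/-- Scattering directions: the unit sphere of `ℝ³`. -/
abbrev Dir : Type := Metric.sphere (0 : Vel) 1

/-- A velocity-internal energy pair `(v, I)`; the energies range over `[0, ∞)`, which is encoded in
the measure `stateMeasure`. -/
abbrev MolState : Type := Vel × ℝ

/-- The collision variables `(σ, r, R)`; `r` and `R` range over `[0, 1]`, which is encoded in
the measure `paramMeasure`. -/
abbrev CollParam : Type := Dir × ℝ × ℝ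

/-- The measure `dv dI` on `ℝ³ × [0, ∞)`. -/
def stateMeasure : Measure MolState :=
  (volume : Measure Vel).prod (volume.restrict (Ici (0 : ℝ)))

/-- The measure `dr dR` on `[0, 1]²`. -/
def unitSquareMeasure : Measure (ℝ × ℝ) :=
  (volume.restrict (Icc (0 : ℝ) 1)).prod (volume.restrict (Icc (0 : ℝ) 1))

/-- The measure `dσ dr dR` on `𝕊² × [0, 1]²`, with `dσ` the surface measure (of total mass `4π`). -/
def paramMeasure : Measure CollParam :=
  (volume : Measure Vel).toSphere.prod unitSquareMeasure

/-- A mixture of `P` polyatomic gases: the molecular masses `m_i > 0` and the exponents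
`α_i > -1`. -/
structure Mixture (P : ℕ) where
  mass : Fin P → ℝ
  mass_pos : ∀ i, 0 < mass i
  alpha : Fin P → ℝ
  alpha_gt : ∀ i, -1 < alpha i

namespace Mixture

/-- The total mass `𝗆 = ∑ m_ℓ`. -/
def totalMass {P : ℕ} (M : Mixture P) : ℝ := ∑ l, M.mass l

/-- The reduced mass `μ_ij`. -/
def reducedMass {P : ℕ} (M : Mixture P) (i j : Fin P) : ℝ :=
  M.mass i * M.mass j / (M.mass i + M.mass j)

/-- The velocity `V_ij` of the center of mass. -/
def centerVel {P : ℕ} (M : Mixture P) (i j : Fin P) (v w : Vel) : Vel :=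
  (M.mass i + M.mass j)⁻¹ • (M.mass i • v + M.mass j • w)

/-- The energy `E_ij = μ_ij |v - v_*|² / 2 + I + I_*`, with `x = (v, I)` and `y = (v_*, I_*)`. -/
def energy {P : ℕ} (M : Mixture P) (i j : Fin P) (x y : MolState) : ℝ :=
  M.reducedMass i j / 2 * ‖x.1 - y.1‖ ^ 2 + x.2 + y.2

/-- The pair `(v', I')`. -/
def primed {P : ℕ} (M : Mixture P) (i j : Fin P) (x y : MolState) (c : CollParam) : MolState :=
  (M.centerVel i j x.1 y.1
      + (M.mass j / (M.mass i + M.mass j)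
          * √(2 * c.2.2 * M.energy i j x y / M.reducedMass i j)) • (c.1 : Vel),
    c.2.1 * (1 - c.2.2) * M.energy i j x y)

/-- The pair `(v'_*, I'_*)`. -/
def primedStar {P : ℕ} (M : Mixture P) (i j : Fin P) (x y : MolState) (c : CollParam) : MolState :=
  (M.centerVel i j x.1 y.1
      - (M.mass i / (M.mass i + M.mass j)
          * √(2 * c.2.2 * M.energy i j x y / M.reducedMass i j)) • (c.1 : Vel),
    (1 - c.2.1) * (1 - c.2.2) * M.energy i j x y)

/-- The parameter `r' = I / (I + I_*)`. -/
def primedr (x y : MolState) : ℝ := x.2 / (x.2 + y.2)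

/-- The parameter `R' = μ_ij |u|² / (2 E_ij)`. -/
def primedR {P : ℕ} (M : Mixture P) (i j : Fin P) (x y : MolState) : ℝ :=
  M.reducedMass i j * ‖x.1 - y.1‖ ^ 2 / (2 * M.energy i j x y)

/-- The function `d_ij(r, R)`. -/
def dens {P : ℕ} (M : Mixture P) (i j : Fin P) (r R : ℝ) : ℝ :=
  r ^ M.alpha i * (1 - r) ^ M.alpha j * (1 - R) ^ (M.alpha i + M.alpha j + 1) * √R

/-- The Lebesgue bracket `⟨v, I⟩_i`. -/
def bracket {P : ℕ} (M : Mixture P) (i : Fin P) (x : MolState) : ℝ :=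
  √(1 + M.mass i / (2 * M.totalMass) * ‖x.1‖ ^ 2 + x.2 / M.totalMass)

/-- The norm of `L^p_{i,k}`, as an extended nonnegative number. -/
def wnorm {P : ℕ} (M : Mixture P) (i : Fin P) (p : ℝ≥0∞) (k : ℝ) (f : MolState → ℝ) : ℝ≥0∞ :=
  eLpNorm (fun x => |f x| * M.bracket i x ^ k) p stateMeasure

/-- The smaller mass ratio `s̄_ij`. -/
def minRatio {P : ℕ} (M : Mixture P) (i j : Fin P) : ℝ :=
  min (M.mass i / (M.mass i + M.mass j)) (M.mass j / (M.mass i + M.mass j))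

/-- The constant `ρ_ij(q)`, for `q ∈ [1, ∞]` (with `1/∞ = 0`). -/
def rho {P : ℕ} (M : Mixture P) (i j : Fin P) (γ : ℝ) (bub : ℝ → ℝ → ℝ) (q : ℝ≥0∞) : ℝ≥0∞ :=
  ∫⁻ s, ENNReal.ofReal (s.1 ^ (-((1 + γ / 2) * q⁻¹.toReal)) * (1 - s.2) ^ (-q⁻¹.toReal)
    * M.dens i j s.1 s.2 * bub s.1 s.2) ∂unitSquareMeasure

/-- The constant `c_ij(q)`. -/
def cConst {P : ℕ} (M : Mixture P) (i j : Fin P) (γ : ℝ) (bub : ℝ → ℝ → ℝ) (q : ℝ≥0∞) : ℝ≥0∞ :=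
  ENNReal.ofReal ((2 : ℝ) ^ (γ / 2 * q⁻¹.toReal) * M.minRatio i j ^ (-((3 + γ) * q⁻¹.toReal)))
    * M.rho i j γ bub q

/-- The assumptions on the collision kernel `B = B_ij(x, y, (σ, r, R))`, `x = (v, I)`,
`y = (v_*, I_*)`, with rate `γ`, angular part `b` and energy exchange part `bub`. Pointwise
requirements on the kernel are imposed for almost all values of its arguments; those with
`v = v_*`, for which `û` is not defined, form a null set. -/
structure IsCollisionKernel {P : ℕ} (M : Mixture P) (i j : Fin P) (γ : ℝ) (b : ℝ → ℝ)
    (bub : ℝ → ℝ → ℝ) (B : MolState → MolState → CollParam → ℝ) : Prop where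
  rate_mem : γ ∈ Icc (0 : ℝ) 2
  angular_nonneg : ∀ t ∈ Icc (-1 : ℝ) 1, 0 ≤ b t
  angular_integrable : IntegrableOn b (Icc (-1) 1)
  exchange_nonneg : ∀ r ∈ Icc (0 : ℝ) 1, ∀ R ∈ Icc (0 : ℝ) 1, 0 ≤ bub r R
  exchange_integrable :
    Integrable (fun s : ℝ × ℝ => bub s.1 s.2 * M.dens i j s.1 s.2) unitSquareMeasure
  measurable : AEMeasurable (fun z : MolState × MolState × CollParam => B z.1 z.2.1 z.2.2)
    (stateMeasure.prod (stateMeasure.prod paramMeasure))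
  nonneg : ∀ᵐ z ∂(stateMeasure.prod (stateMeasure.prod paramMeasure)), 0 ≤ B z.1 z.2.1 z.2.2
  upper_bound : ∀ᵐ z ∂(stateMeasure.prod (stateMeasure.prod paramMeasure)),
    B z.1 z.2.1 z.2.2 ≤
      b (inner ℝ (‖z.1.1 - z.2.1.1‖⁻¹ • (z.1.1 - z.2.1.1)) (z.2.2.1 : Vel))
        * bub z.2.2.2.1 z.2.2.2.2 * (M.energy i j z.1 z.2.1 / M.totalMass) ^ (γ / 2)
  /-- Microreversibility under the interchange of pre- and postcollisional molecules. -/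
  microreversible : ∀ᵐ z ∂(stateMeasure.prod (stateMeasure.prod paramMeasure)),
    ∀ σ' : Dir, (σ' : Vel) = ‖z.1.1 - z.2.1.1‖⁻¹ • (z.1.1 - z.2.1.1) →
      B z.1 z.2.1 z.2.2 =
        B (M.primed i j z.1 z.2.1 z.2.2) (M.primedStar i j z.1 z.2.1 z.2.2)
          (σ', primedr z.1 z.2.1, M.primedR i j z.1 z.2.1)

/-- The integrand of the gain operator at `x = (v, I)`, as a function of
`w = ((v_*, I_*), (σ, r, R))`. -/
def gainIntegrand {P : ℕ} (M : Mixture P) (i j : Fin P)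
    (B : MolState → MolState → CollParam → ℝ) (f g : MolState → ℝ) (x : MolState)
    (w : MolState × CollParam) : ℝ :=
  f (M.primed i j x w.1 w.2) * g (M.primedStar i j x w.1 w.2)
    * (x.2 / (M.primed i j x w.1 w.2).2) ^ M.alpha i
    * (w.1.2 / (M.primedStar i j x w.1 w.2).2) ^ M.alpha j
    * B x w.1 w.2 * M.dens i j w.2.2.1 w.2.2.2

/-- The gain operator `Q⁺_ij(f, g)`. -/
def gain {P : ℕ} (M : Mixture P) (i j : Fin P)
    (B : MolState → MolState → CollParam → ℝ) (f g : MolState → ℝ) (x : MolState) : ℝ :=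
  ∫ w, M.gainIntegrand i j B f g x w ∂(stateMeasure.prod paramMeasure)

end Mixture

/-- The forward part `b⁺` of the angular kernel. -/
def fwd (b : ℝ → ℝ) : ℝ → ℝ := {t : ℝ | 0 ≤ t}.indicator b

/-- The backward part `b⁻` of the angular kernel. -/
def bwd (b : ℝ → ℝ) : ℝ → ℝ := {t : ℝ | t ≤ 0}.indicator b

/-- The norm `‖b‖_{L¹} = 2π ∫_{-1}^{1} |b(t)| dt` of the function `σ ↦ b(û · σ)` on the sphere. -/
def angNorm (b : ℝ → ℝ) : ℝ≥0∞ :=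
  ENNReal.ofReal (2 * Real.pi) * ∫⁻ t in Icc (-1 : ℝ) 1, ‖b t‖ₑ

/-- The right-hand side of the estimate, with values in `[0, ∞]` and the convention `0 · ∞ = 0`. -/
def Mixture.weakBound {P : ℕ} (M : Mixture P) (i j : Fin P) (γ : ℝ) (b : ℝ → ℝ)
    (bub : ℝ → ℝ → ℝ) (p q : ℝ≥0∞) (k : ℝ) (f g χ : MolState → ℝ) : ℝ≥0∞ :=
  ENNReal.ofReal ((2 : ℝ) ^ (q⁻¹.toReal / 2)) * M.cConst i j γ bub q
    * (angNorm (fwd b) * M.wnorm i p ((k + γ) * p⁻¹.toReal) f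
          * M.wnorm j 1 (k * p⁻¹.toReal + γ) g
        + angNorm (bwd b) * M.wnorm i 1 (k * p⁻¹.toReal + γ) f
          * M.wnorm j p ((k + γ) * p⁻¹.toReal) g)
    * M.wnorm i q ((k + γ) * q⁻¹.toReal) χ

end

/-!
The gain operator is estimated in its weak form, with absolute values and in `[0, ∞]`; Fubini's
theorem then gives all the claims.

*Weak form.* In terms of the center of mass velocity `V`, the energy `E` and parameters `c' = (σ',
r', R')`, the pair of molecules before the collision is `collState (V, E) c'`, the pair after it is
`collState (V, E) c`, and the collision just interchanges `c'` and `c` (`primed_collState`,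
`lintegral_pair_eq`). The weight `(I / I')^α_i (I_* / I'_*)^α_j d_ij(r, R)` times the Jacobian at
`c'` is `d_ij(r', R')` times the Jacobian at `c` (`weight_mul_collJac`). So, by microreversibility
and the upper bound of the kernel, the weak form is at most the integral of `f(x) g(y) χ(x') ⟨x'⟩^k`
against `b(û · σ) b̃(r, R) d_ij(r, R) (E / 𝗆)^(γ/2)`, where `x`, `y` are now the molecules before
the collision (`lintegral_collMeasure_le_of_swap`, `IsCollisionKernel.lintegral_gainIntegrand_le`).

*Forward part.* Split `b = b⁺ + b⁻`. For fixed `y` and parameters, `x ↦ x'` has a constant Jacobian,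
a power of the mass ratio times `r (1 - R)`. The direction `û` before the collision is not a
function of `σ` and `x'` alone, but integrating over `σ` for fixed `x'` and `y` replaces `b⁺(û · σ)`
by its norm at most (`lintegral_sphere_deflected_le`): writing `s` for the cosine of the angle of
`û` and `σ`, and `t` for that of `v' - v_*` and `σ`, one has `ds/dt ≥ 1` where `s ≥ 0`, while the
surface measure is uniform in `t` by Archimedes' theorem (`lintegral_sphere_inner`). Since `û · σ ≥
0`, `E / 𝗆` is at most `(s̄² r)⁻¹` times the product of the squared brackets of `x'` and `y`
(`energy_le_of_inner_nonneg`); always `E / 𝗆 ≤ (⟨x⟩ ⟨y⟩)²` and `⟨x'⟩ ≤ ⟨x⟩ ⟨y⟩`. The second and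
third bounds are used to the power `1/p`, the first to the power `1/q` (`rpow_mul_rpow_le_weights`),
and Hölder's inequality in `x` and `σ` with exponents `p`, `q` gives the claim
(`lintegral_mul_collision_le`). The factor `r⁻¹` of the energy bound and the Jacobian, both to
powers proportional to `1/q`, make up `ρ_ij(q)`.

*Backward part.* Now `x` is fixed and `y ↦ x'` is the change of variables. Seen from `x`, the
relative velocity is reflected, so that the same estimate of the angular average applies to `b⁻`,
and `E` is controlled by the brackets of `x'` and `x` (`energy_le_of_inner_nonpos`). The powers of
`2` in the bound are not needed.
-/

noncomputable section

/-! ### Integration on the sphere -/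

/-- Integration in polar coordinates, for nonnegative functions. -/
theorem lintegral_eq_lintegral_toSphere {E : Type*} [NormedAddCommGroup E] [NormedSpace ℝ E]
    [MeasurableSpace E] [BorelSpace E] [FiniteDimensional ℝ E] [Nontrivial E] (μ : Measure E)
    [μ.IsAddHaarMeasure] {f : E → ℝ≥0∞} (hf : Measurable f) :
    ∫⁻ x, f x ∂μ = ∫⁻ σ : Metric.sphere (0 : E) 1, (∫⁻ r in Ioi (0 : ℝ),
      ENNReal.ofReal (r ^ (Module.finrank ℝ E - 1)) * f (r • (σ : E))) ∂μ.toSphere := by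
  have hmp := μ.measurePreserving_homeomorphUnitSphereProd
  have hg : Measurable (fun y : Metric.sphere (0 : E) 1 × Ioi (0 : ℝ) => f (y.2.1 • (y.1 : E))) := by
    fun_prop
  calc ∫⁻ x, f x ∂μ = ∫⁻ x : ({(0)}ᶜ : Set E), f x ∂(μ.comap (↑)) := by
        rw [lintegral_subtype_comap (measurableSet_singleton _).compl, restrict_compl_singleton]
    _ = ∫⁻ y, f (y.2.1 • (y.1 : E)) ∂(μ.toSphere.prod
          (Measure.volumeIoiPow (Module.finrank ℝ E - 1))) := by
        rw [← hmp.lintegral_comp hg]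
        refine lintegral_congr fun x => ?_
        have hx : ‖(x : E)‖ ≠ 0 := norm_ne_zero_iff.2 x.2
        simp [smul_smul, hx]
    _ = _ := by
        rw [lintegral_prod _ hg.aemeasurable]
        refine lintegral_congr fun σ => ?_
        have h1 : Measurable fun r : Ioi (0 : ℝ) =>
            ENNReal.ofReal (r.1 ^ (Module.finrank ℝ E - 1)) := by fun_prop
        rw [Measure.volumeIoiPow, lintegral_withDensity_eq_lintegral_mul _ h1 (by fun_prop)]
        exact lintegral_subtype_comap measurableSet_Ioi
          (fun r : ℝ => ENNReal.ofReal (r ^ (Module.finrank ℝ E - 1)) * f (r • (σ : E)))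

theorem lintegral_comp_smul_of_pos {E : Type*} [NormedAddCommGroup E] [NormedSpace ℝ E]
    [MeasurableSpace E] [BorelSpace E] [FiniteDimensional ℝ E] (μ : Measure E)
    [μ.IsAddHaarMeasure] {f : E → ℝ≥0∞} (hf : Measurable f) {c : ℝ} (hc : 0 < c) :
    ∫⁻ x, f (c • x) ∂μ = ENNReal.ofReal ((c ^ Module.finrank ℝ E)⁻¹) * ∫⁻ x, f x ∂μ := by
  rw [← lintegral_map hf (measurable_const_smul c), Measure.map_addHaar_smul μ hc.ne',
    lintegral_smul_measure, abs_of_pos (by positivity), smul_eq_mul]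

/-- Cylindrical coordinates around the axis `e`. -/
theorem lintegral_inner_norm {e : Vel} (he : ‖e‖ = 1) {G : ℝ → ℝ → ℝ≥0∞}
    (hG : Measurable (Function.uncurry G)) :
    ∫⁻ x : Vel, G (inner ℝ e x) ‖x‖ = ∫⁻ z : ℝ, ∫⁻ ρ in Ioi (0 : ℝ),
      ENNReal.ofReal (2 * Real.pi) * (ENNReal.ofReal ρ * G z √(z ^ 2 + ρ ^ 2)) := by
  obtain ⟨b, hb⟩ : ∃ b : OrthonormalBasis (Fin 3) ℝ Vel, ∀ i ∈ ({0} : Set (Fin 3)), b i = e := by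
    refine Orthonormal.exists_orthonormalBasis_extension_of_card_eq (v := fun _ => e)
      (by simp) ?_
    rw [orthonormal_iff_ite]
    rintro ⟨i, rfl⟩ ⟨j, rfl⟩
    simp [he]
  have hb0 : b 0 = e := hb 0 rfl
  have h1 : ∫⁻ x : Vel, G (inner ℝ e x) ‖x‖ = ∫⁻ y : Vel, G (y 0) ‖y‖ := by
    have := b.measurePreserving_repr.lintegral_comp_emb
      b.repr.toHomeomorph.measurableEmbedding (fun y => G (y 0) ‖y‖)
    simpa [b.repr_apply_apply, hb0] using this
  have h2 : ∫⁻ y : Vel, G (y 0) ‖y‖ = ∫⁻ y : Fin 3 → ℝ, G (y 0) √(∑ i, y i ^ 2) := by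
    rw [← (PiLp.volume_preserving_ofLp (Fin 3)).lintegral_comp_emb
      (MeasurableEquiv.toLp 2 (Fin 3 → ℝ)).symm.measurableEmbedding]
    simp [EuclideanSpace.norm_eq]
  have h3 : ∫⁻ y : Fin 3 → ℝ, G (y 0) √(∑ i, y i ^ 2)
      = ∫⁻ z : ℝ × (Fin 2 → ℝ), G z.1 √(z.1 ^ 2 + ∑ i, z.2 i ^ 2) := by
    rw [← (volume_preserving_piFinSuccAbove (fun _ : Fin 3 => ℝ) 0).lintegral_comp_emb
      (MeasurableEquiv.measurableEmbedding _)]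
    refine lintegral_congr fun y => ?_
    simp [Fin.sum_univ_succ, MeasurableEquiv.piFinSuccAbove, Fin.insertNthEquiv, Fin.tail]
  have hm : Measurable fun z : ℝ × (Fin 2 → ℝ) => G z.1 √(z.1 ^ 2 + ∑ i, z.2 i ^ 2) := by
    have : Measurable fun z : ℝ × (Fin 2 → ℝ) => (z.1, √(z.1 ^ 2 + ∑ i, z.2 i ^ 2)) := by
      fun_prop
    exact hG.comp this
  rw [h1, h2, h3, Measure.volume_eq_prod, lintegral_prod _ hm.aemeasurable]
  refine lintegral_congr fun z => ?_
  have hGz : Measurable fun s => G z √(z ^ 2 + s ^ 2) := by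
    have : Measurable fun s : ℝ => (z, √(z ^ 2 + s ^ 2)) := by fun_prop
    exact hG.comp this
  have h4 : ∫⁻ p : Fin 2 → ℝ, G z √(z ^ 2 + ∑ i, p i ^ 2)
      = ∫⁻ p : EuclideanSpace ℝ (Fin 2), G z √(z ^ 2 + ‖p‖ ^ 2) := by
    rw [← (PiLp.volume_preserving_ofLp (Fin 2)).lintegral_comp_emb
      (MeasurableEquiv.toLp 2 (Fin 2 → ℝ)).symm.measurableEmbedding]
    simp [EuclideanSpace.norm_sq_eq]
  rw [h4, lintegral_eq_lintegral_toSphere (f := fun p => G z √(z ^ 2 + ‖p‖ ^ 2)) _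
    (hGz.comp measurable_norm)]
  have h5 : ∀ σ : Metric.sphere (0 : EuclideanSpace ℝ (Fin 2)) 1,
      ∫⁻ r in Ioi (0 : ℝ), ENNReal.ofReal (r ^ (Module.finrank ℝ (EuclideanSpace ℝ (Fin 2)) - 1))
        * G z √(z ^ 2 + ‖r • (σ : EuclideanSpace ℝ (Fin 2))‖ ^ 2)
      = ∫⁻ r in Ioi (0 : ℝ), ENNReal.ofReal r * G z √(z ^ 2 + r ^ 2) := by
    intro σ
    refine setLIntegral_congr_fun measurableSet_Ioi fun r hr => ?_
    simp [norm_smul]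
  simp only [h5]
  rw [lintegral_const, Measure.toSphere_apply_univ, lintegral_const_mul, mul_comm]
  · congr 1
    rw [EuclideanSpace.volume_ball_fin_two]
    simp [ENNReal.ofReal_mul]
  · fun_prop

/-- The substitution `t = z / √(z² + ρ²)`, which is the height `z` of a point at distance `ρ` from
the axis, divided by its distance from the origin. -/
theorem lintegral_subst_div_sqrt {ρ : ℝ} (hρ : 0 < ρ) (f : ℝ → ℝ≥0∞) :
    ∫⁻ z, f z = ∫⁻ t in Ioo (-1 : ℝ) 1,
      ENNReal.ofReal (ρ / √(1 - t ^ 2) ^ 3) * f (ρ * t / √(1 - t ^ 2)) := by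
  have hpos : ∀ t ∈ Ioo (-1 : ℝ) 1, 0 < 1 - t ^ 2 := fun t ht => by nlinarith [ht.1, ht.2]
  have hd : ∀ t ∈ Ioo (-1 : ℝ) 1, HasDerivWithinAt (fun t => ρ * t / √(1 - t ^ 2))
      (ρ / √(1 - t ^ 2) ^ 3) (Ioo (-1) 1) t := by
    intro t ht
    have h0 := hpos t ht
    have hs : √(1 - t ^ 2) ^ 2 = 1 - t ^ 2 := Real.sq_sqrt h0.le
    have hs0 : 0 < √(1 - t ^ 2) := Real.sqrt_pos.2 h0
    have h1 : HasDerivAt (fun t : ℝ => √(1 - t ^ 2)) ((-(2 * t)) / (2 * √(1 - t ^ 2))) t := by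
      have : HasDerivAt (fun t : ℝ => 1 - t ^ 2) (-(2 * t)) t := by
        simpa using (hasDerivAt_pow 2 t).const_sub 1
      exact this.sqrt h0.ne'
    have h2 := (((hasDerivAt_id t).const_mul ρ).div h1 hs0.ne').hasDerivWithinAt (s := Ioo (-1) 1)
    refine h2.congr_deriv ?_
    field_simp
    simp only [id]
    linear_combination hs
  have hinv : ∀ z : ℝ, z / √(z ^ 2 + ρ ^ 2) ∈ Ioo (-1 : ℝ) 1 ∧
      ρ * (z / √(z ^ 2 + ρ ^ 2)) / √(1 - (z / √(z ^ 2 + ρ ^ 2)) ^ 2) = z := by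
    intro z
    have h0 : 0 < z ^ 2 + ρ ^ 2 := by positivity
    have hs : √(z ^ 2 + ρ ^ 2) ^ 2 = z ^ 2 + ρ ^ 2 := Real.sq_sqrt h0.le
    have hs0 : 0 < √(z ^ 2 + ρ ^ 2) := Real.sqrt_pos.2 h0
    have h1 : 1 - (z / √(z ^ 2 + ρ ^ 2)) ^ 2 = (ρ / √(z ^ 2 + ρ ^ 2)) ^ 2 := by
      rw [div_pow, div_pow, hs]; field_simp; ring
    refine ⟨abs_lt.1 ?_, ?_⟩
    · rw [abs_div, abs_of_pos hs0, div_lt_one hs0]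
      exact Real.lt_sqrt_of_sq_lt (by rw [sq_abs]; nlinarith)
    · rw [h1, Real.sqrt_sq (by positivity)]
      field_simp
  have hleft : ∀ t ∈ Ioo (-1 : ℝ) 1, (ρ * t / √(1 - t ^ 2)) /
      √((ρ * t / √(1 - t ^ 2)) ^ 2 + ρ ^ 2) = t := by
    intro t ht
    have h0 := hpos t ht
    have hs : √(1 - t ^ 2) ^ 2 = 1 - t ^ 2 := Real.sq_sqrt h0.le
    have hs0 : 0 < √(1 - t ^ 2) := Real.sqrt_pos.2 h0
    have h1 : (ρ * t / √(1 - t ^ 2)) ^ 2 + ρ ^ 2 = (ρ / √(1 - t ^ 2)) ^ 2 := by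
      rw [div_pow, div_pow, hs]; field_simp; ring
    rw [h1, Real.sqrt_sq (by positivity)]
    field_simp
  have hinj : InjOn (fun t => ρ * t / √(1 - t ^ 2)) (Ioo (-1 : ℝ) 1) := by
    intro t ht s hs hts
    simp only at hts
    rw [← hleft t ht, ← hleft s hs, hts]
  have himg : (fun t => ρ * t / √(1 - t ^ 2)) '' Ioo (-1 : ℝ) 1 = univ :=
    eq_univ_of_forall fun z => ⟨_, (hinv z).1, (hinv z).2⟩
  rw [← setLIntegral_univ, ← himg,
    lintegral_image_eq_lintegral_abs_deriv_mul measurableSet_Ioo hd hinj]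
  refine setLIntegral_congr_fun measurableSet_Ioo fun t ht => ?_
  rw [abs_of_nonneg (by positivity)]

theorem lintegral_Ioo_sq {a : ℝ} (ha : 0 ≤ a) :
    ∫⁻ r in Ioo (0 : ℝ) a, ENNReal.ofReal (r ^ 2) = ENNReal.ofReal (a ^ 3 / 3) := by
  rw [restrict_Ioo_eq_restrict_Ioc, ← ofReal_integral_eq_lintegral_ofReal,
    ← intervalIntegral.integral_of_le ha, integral_pow]
  · norm_num
  · exact (intervalIntegral.intervalIntegrable_pow 2).1
  · exact ae_of_all _ fun r => sq_nonneg r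

/-- Archimedes' theorem: under the surface measure of `𝕊²`, the height above the equator is
uniformly distributed. -/
theorem lintegral_sphere_inner {e : Vel} (he : ‖e‖ = 1) {F : ℝ → ℝ≥0∞} (hF : Measurable F) :
    ∫⁻ σ : Dir, F (inner ℝ e (σ : Vel)) ∂(volume : Measure Vel).toSphere
      = ENNReal.ofReal (2 * Real.pi) * ∫⁻ t in Ioo (-1 : ℝ) 1, F t := by
  -- Both sides are a third of the integral of `x ↦ F (e · x / |x|)` over the unit ball.
  let G : ℝ → ℝ → ℝ≥0∞ := fun z s => (Iio (1 : ℝ)).indicator 1 s * F (z / s)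
  have hG : Measurable (Function.uncurry G) :=
    ((measurable_one.indicator measurableSet_Iio).comp measurable_snd).mul
      (hF.comp (measurable_fst.div measurable_snd))
  have h13 : ∫⁻ r in Ioi (0 : ℝ), ENNReal.ofReal (r ^ 2) * (Iio (1 : ℝ)).indicator 1 r
      = ENNReal.ofReal (1 / 3) := by
    rw [← one_pow 3, ← lintegral_Ioo_sq zero_le_one, ← Ioi_inter_Iio, inter_comm,
      ← Measure.restrict_restrict measurableSet_Iio, ← lintegral_indicator measurableSet_Iio]
    refine lintegral_congr fun r => ?_
    by_cases hr : r < 1 <;> simp [indicator, hr]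
  have hpolar : ∫⁻ x : Vel, G (inner ℝ e x) ‖x‖ = ENNReal.ofReal (1 / 3) *
      ∫⁻ σ : Dir, F (inner ℝ e (σ : Vel)) ∂(volume : Measure Vel).toSphere := by
    have hm : Measurable fun x : Vel => G (inner ℝ e x) ‖x‖ := by
      have : Measurable fun x : Vel => (inner ℝ e x, ‖x‖) := by fun_prop
      exact hG.comp this
    rw [lintegral_eq_lintegral_toSphere _ hm, ← lintegral_const_mul]
    · refine lintegral_congr fun σ => ?_
      rw [← h13, ← lintegral_mul_const]
      · refine setLIntegral_congr_fun measurableSet_Ioi fun r hr => ?_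
        have hr : 0 < r := hr
        simp [G, norm_smul, inner_smul_right, abs_of_pos hr, hr.ne', mul_assoc]
      · exact Measurable.mul (by fun_prop) (measurable_one.indicator measurableSet_Iio)
    · exact hF.comp (by fun_prop)
  have hcyl : ∫⁻ x : Vel, G (inner ℝ e x) ‖x‖ = ENNReal.ofReal (1 / 3) *
      (ENNReal.ofReal (2 * Real.pi) * ∫⁻ t in Ioo (-1 : ℝ) 1, F t) := by
    have hm : Measurable fun x : ℝ × ℝ => ENNReal.ofReal (2 * Real.pi) *
        (ENNReal.ofReal x.2 * G x.1 √(x.1 ^ 2 + x.2 ^ 2)) := by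
      have : Measurable fun x : ℝ × ℝ => (x.1, √(x.1 ^ 2 + x.2 ^ 2)) := by fun_prop
      exact Measurable.const_mul (Measurable.mul (by fun_prop) (hG.comp this)) _
    rw [lintegral_inner_norm he hG, lintegral_lintegral_swap hm.aemeasurable]
    have hsub : ∀ ρ ∈ Ioi (0 : ℝ), ∫⁻ z : ℝ, ENNReal.ofReal (2 * Real.pi) *
          (ENNReal.ofReal ρ * G z √(z ^ 2 + ρ ^ 2))
        = ∫⁻ t in Ioo (-1 : ℝ) 1, ENNReal.ofReal (2 * Real.pi) * (F t *
          (ENNReal.ofReal ((√(1 - t ^ 2) ^ 3)⁻¹) * ((Iio √(1 - t ^ 2)).indicator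
            (fun r => ENNReal.ofReal (r ^ 2)) ρ))) := by
      intro ρ hρ
      have hρ : 0 < ρ := hρ
      rw [lintegral_subst_div_sqrt hρ]
      refine setLIntegral_congr_fun measurableSet_Ioo fun t ht => ?_
      have h0 : 0 < 1 - t ^ 2 := by nlinarith [ht.1, ht.2]
      have hs : √(1 - t ^ 2) ^ 2 = 1 - t ^ 2 := Real.sq_sqrt h0.le
      have hs0 : 0 < √(1 - t ^ 2) := Real.sqrt_pos.2 h0
      have h1 : (ρ * t / √(1 - t ^ 2)) ^ 2 + ρ ^ 2 = (ρ / √(1 - t ^ 2)) ^ 2 := by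
        rw [div_pow, div_pow, hs]; field_simp; ring
      have h2 : ρ * t / √(1 - t ^ 2) / (ρ / √(1 - t ^ 2)) = t := by field_simp
      simp only [G]
      rw [h1, Real.sqrt_sq (by positivity), h2]
      by_cases hlt : ρ < √(1 - t ^ 2)
      · have hlt' : ρ / √(1 - t ^ 2) < 1 := (div_lt_one hs0).2 hlt
        simp only [indicator, mem_Iio, hlt, hlt', if_true, Pi.one_apply, one_mul]
        rw [div_eq_mul_inv, ENNReal.ofReal_mul hρ.le, sq ρ, ENNReal.ofReal_mul hρ.le]
        ring
      · have hlt' : ¬ ρ / √(1 - t ^ 2) < 1 := fun h => hlt ((div_lt_one hs0).1 h)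
        simp [indicator, hlt, hlt']
    rw [setLIntegral_congr_fun measurableSet_Ioi hsub, lintegral_lintegral_swap,
      ← lintegral_const_mul _ hF, ← lintegral_const_mul _ (by fun_prop)]
    · refine setLIntegral_congr_fun measurableSet_Ioo fun t ht => ?_
      have h0 : 0 < 1 - t ^ 2 := by nlinarith [ht.1, ht.2]
      have hs0 : 0 < √(1 - t ^ 2) := Real.sqrt_pos.2 h0
      have hmi : Measurable ((Iio √(1 - t ^ 2)).indicator
            (fun r : ℝ => ENNReal.ofReal (r ^ 2))) :=
        Measurable.indicator (by fun_prop) measurableSet_Iio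
      rw [lintegral_const_mul _ ((hmi.const_mul _).const_mul _),
        lintegral_const_mul _ (hmi.const_mul _), lintegral_const_mul _ hmi,
        lintegral_indicator measurableSet_Iio, Measure.restrict_restrict measurableSet_Iio,
        inter_comm, Ioi_inter_Iio, lintegral_Ioo_sq hs0.le, ← ENNReal.ofReal_mul (by positivity)]
      have : (√(1 - t ^ 2) ^ 3)⁻¹ * (√(1 - t ^ 2) ^ 3 / 3) = 1 / 3 := by field_simp
      rw [this]
      ring
    · refine Measurable.aemeasurable ?_
      have hS : MeasurableSet {y : ℝ × ℝ | y.1 < √(1 - y.2 ^ 2)} :=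
        measurableSet_lt (by fun_prop) (by fun_prop)
      have h3 : Measurable (indicator {y : ℝ × ℝ | y.1 < √(1 - y.2 ^ 2)}
          (fun y => ENNReal.ofReal (y.1 ^ 2))) :=
        Measurable.indicator (by fun_prop) hS
      exact Measurable.const_mul (Measurable.mul (by fun_prop)
        (Measurable.mul (by fun_prop) h3)) _
  have h3 : ENNReal.ofReal (1 / 3) ≠ 0 := by simp
  exact (ENNReal.mul_right_inj h3 ENNReal.ofReal_ne_top).1 (hpolar.symm.trans hcyl)

/-- Deflecting a fixed vector `w` by `-aσ` does not increase the forward part of an angular kernel: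
with `s` the cosine of the angle between `w - aσ` and `σ` and `t` that between `w` and `σ`, one has
`ds/dt ≥ 1` on the set where `s ≥ 0`. -/
theorem lintegral_sphere_deflected_le {w : Vel} (hw : w ≠ 0) {a : ℝ} (ha : 0 ≤ a) {h : ℝ → ℝ≥0∞}
    (hh : Measurable h) (hsupp : ∀ t < 0, h t = 0) :
    ∫⁻ σ : Dir, h (inner ℝ (‖w - a • (σ : Vel)‖⁻¹ • (w - a • (σ : Vel))) (σ : Vel))
        ∂(volume : Measure Vel).toSphere
      ≤ ENNReal.ofReal (2 * Real.pi) * ∫⁻ t in Icc (-1 : ℝ) 1, h t := by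
  have hw0 : 0 < ‖w‖ := norm_pos_iff.2 hw
  obtain ⟨A, hA0, haA⟩ : ∃ A : ℝ, 0 ≤ A ∧ a = ‖w‖ * A := ⟨a / ‖w‖, by positivity, by field_simp⟩
  let s : ℝ → ℝ := fun t => (t - A) / √(1 + A ^ 2 - 2 * A * t)
  have hs : Measurable s := by fun_prop
  obtain ⟨e, he1, hwe⟩ : ∃ e : Vel, ‖e‖ = 1 ∧ w = ‖w‖ • e :=
    ⟨‖w‖⁻¹ • w, by simp [norm_smul, hw0.ne'], by simp [smul_smul, hw0.ne']⟩
  have hpt : ∀ σ : Dir, inner ℝ (‖w - a • (σ : Vel)‖⁻¹ • (w - a • (σ : Vel))) (σ : Vel)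
      = s (inner ℝ e (σ : Vel)) := by
    intro σ
    have hσ : ‖(σ : Vel)‖ = 1 := by simp
    have h1 : w - a • (σ : Vel) = ‖w‖ • (e - A • (σ : Vel)) := by
      rw [smul_sub, smul_smul, ← hwe, ← haA]
    have h2 : ‖e - A • (σ : Vel)‖ = √(1 + A ^ 2 - 2 * A * inner ℝ e (σ : Vel)) := by
      rw [← Real.sqrt_sq (norm_nonneg (e - A • (σ : Vel))), norm_sub_sq_real, he1, norm_smul, hσ,
        inner_smul_right, Real.norm_eq_abs, mul_one, sq_abs]
      congr 1
      ring
    rw [h1, norm_smul, smul_smul, norm_norm, mul_inv, mul_comm ‖w‖⁻¹, mul_assoc,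
      inv_mul_cancel₀ hw0.ne', mul_one, real_inner_smul_left, inner_sub_left,
      real_inner_smul_left, real_inner_self_eq_norm_sq, hσ, h2]
    simp only [s]
    ring
  simp_rw [hpt]
  rw [lintegral_sphere_inner (F := fun t => h (s t)) he1 (hh.comp hs)]
  gcongr ENNReal.ofReal _ * ?_
  have hpos : ∀ t ∈ Ioo A 1, 0 < 1 + A ^ 2 - 2 * A * t := by
    intro t ht
    nlinarith [ht.1, ht.2, mul_nonneg hA0 (sub_nonneg.2 ht.2.le), sq_nonneg (1 - A)]
  have hd : ∀ t ∈ Ioo A 1, HasDerivWithinAt s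
      ((1 - A * t) / √(1 + A ^ 2 - 2 * A * t) ^ 3) (Ioo A 1) t := by
    intro t ht
    have h0 := hpos t ht
    have hq : √(1 + A ^ 2 - 2 * A * t) ^ 2 = 1 + A ^ 2 - 2 * A * t := Real.sq_sqrt h0.le
    have hq0 : 0 < √(1 + A ^ 2 - 2 * A * t) := Real.sqrt_pos.2 h0
    have h1 : HasDerivAt (fun t : ℝ => 1 + A ^ 2 - 2 * A * t) (-(2 * A)) t := by
      simpa using ((hasDerivAt_id t).const_mul (2 * A)).const_sub (1 + A ^ 2)
    have h2 := (((hasDerivAt_id t).sub_const A).div (h1.sqrt h0.ne') hq0.ne').hasDerivWithinAt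
      (s := Ioo A 1)
    refine h2.congr_deriv ?_
    generalize √(1 + A ^ 2 - 2 * A * t) = D at hq hq0
    field_simp
    simp only [id]
    linear_combination hq
  have hd1 : ∀ t ∈ Ioo A 1, 1 ≤ (1 - A * t) / √(1 + A ^ 2 - 2 * A * t) ^ 3 := by
    intro t ht
    have h0 := hpos t ht
    have hq : √(1 + A ^ 2 - 2 * A * t) ^ 2 = 1 + A ^ 2 - 2 * A * t := Real.sq_sqrt h0.le
    have hq0 : 0 < √(1 + A ^ 2 - 2 * A * t) := Real.sqrt_pos.2 h0
    have hle : 1 + A ^ 2 - 2 * A * t ≤ 1 - A * t := by nlinarith [mul_nonneg hA0 (sub_nonneg.2 ht.1.le)]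
    have hq1 : √(1 + A ^ 2 - 2 * A * t) ≤ 1 := by
      refine Real.sqrt_le_iff.2 ⟨zero_le_one, ?_⟩
      nlinarith [mul_nonneg hA0 (sub_nonneg.2 ht.1.le), mul_nonneg hA0 (hA0.trans ht.1.le)]
    rw [le_div_iff₀ (by positivity), pow_succ, hq]
    nlinarith
  have hsmem : ∀ t ∈ Ioo A 1, s t ∈ Icc (-1 : ℝ) 1 := by
    intro t ht
    have h0 := hpos t ht
    have hq0 : 0 < √(1 + A ^ 2 - 2 * A * t) := Real.sqrt_pos.2 h0
    have h1 : 0 < t - A := sub_pos.2 ht.1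
    refine ⟨(by norm_num : (-1 : ℝ) ≤ 0).trans (by positivity), ?_⟩
    rw [div_le_one hq0]
    refine Real.le_sqrt_of_sq_le ?_
    nlinarith [ht.2, hA0.trans ht.1.le]
  have hmono : StrictMonoOn s (Ioo A 1) := by
    refine strictMonoOn_of_hasDerivWithinAt_pos (convex_Ioo _ _)
      (fun t ht => (hd t ht).continuousWithinAt) (by rwa [interior_Ioo])
      (fun t ht => ?_)
    rw [interior_Ioo] at ht
    exact zero_lt_one.trans_le (hd1 t ht)
  calc ∫⁻ t in Ioo (-1 : ℝ) 1, h (s t)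
      ≤ ∫⁻ t in Ioo A 1, h (s t) := by
        rw [← lintegral_indicator measurableSet_Ioo, ← lintegral_indicator measurableSet_Ioo]
        refine lintegral_mono_ae ?_
        have hne : ∀ᵐ t : ℝ, t ≠ A := by simp [ae_iff]
        filter_upwards [hne] with t ht
        by_cases h1 : t ∈ Ioo (-1 : ℝ) 1
        · rcases lt_or_gt_of_ne ht with hlt | hgt
          · rw [indicator_of_mem h1]
            have hq : 0 < 1 + A ^ 2 - 2 * A * t := by
              nlinarith [h1.1, h1.2, mul_nonneg hA0 (sub_nonneg.2 h1.2.le), sq_nonneg (1 - A)]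
            have : s t < 0 := div_neg_of_neg_of_pos (sub_neg.2 hlt) (Real.sqrt_pos.2 hq)
            simp [hsupp _ this]
          · rw [indicator_of_mem h1, indicator_of_mem (show t ∈ Ioo A 1 from ⟨hgt, h1.2⟩)]
        · simp [indicator_of_notMem h1]
    _ ≤ ∫⁻ t in Ioo A 1, ENNReal.ofReal |(1 - A * t) / √(1 + A ^ 2 - 2 * A * t) ^ 3| * h (s t) := by
        refine setLIntegral_mono' measurableSet_Ioo fun t ht => ?_
        have : 1 ≤ ENNReal.ofReal |(1 - A * t) / √(1 + A ^ 2 - 2 * A * t) ^ 3| :=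
          ENNReal.one_le_ofReal.2 ((hd1 t ht).trans (le_abs_self _))
        simpa using mul_le_mul_left this (h (s t))
    _ = ∫⁻ t in s '' Ioo A 1, h t :=
        (lintegral_image_eq_lintegral_abs_deriv_mul measurableSet_Ioo hd hmono.injOn h).symm
    _ ≤ ∫⁻ t in Icc (-1 : ℝ) 1, h t :=
        lintegral_mono_set (image_subset_iff.2 hsmem)

/-! ### The change of variables `(v, I) ↦ (v', I')` with the other molecule fixed -/

theorem setLIntegral_Ici_comp_mul {κ : ℝ} (hκ : 0 < κ) {f : ℝ → ℝ≥0∞} (hf : Measurable f) :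
    ∫⁻ t in Ici (0 : ℝ), f (κ * t) = ENNReal.ofReal κ⁻¹ * ∫⁻ t in Ici (0 : ℝ), f t := by
  rw [← lintegral_indicator measurableSet_Ici, ← lintegral_indicator measurableSet_Ici]
  have := lintegral_comp_smul_of_pos (volume : Measure ℝ) (hf.indicator measurableSet_Ici) hκ
    (f := (Ici (0 : ℝ)).indicator f)
  simp only [Module.finrank_self, pow_one, smul_eq_mul] at this
  rw [← this]
  refine lintegral_congr fun t => ?_
  simp [indicator, mul_nonneg_iff_of_pos_left hκ]

theorem setLIntegral_Ici_comp_add_le {b : ℝ} (hb : 0 ≤ b) (f : ℝ → ℝ≥0∞) :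
    ∫⁻ t in Ici (0 : ℝ), f (t + b) ≤ ∫⁻ t in Ici (0 : ℝ), f t := by
  rw [← lintegral_indicator measurableSet_Ici, ← lintegral_indicator measurableSet_Ici,
    ← lintegral_add_right_eq_self ((Ici (0 : ℝ)).indicator f) b]
  refine lintegral_mono fun t => ?_
  by_cases ht : 0 ≤ t
  · simp [indicator, ht, add_nonneg ht hb]
  · simp [indicator, ht]

theorem lintegral_stateMeasure {f : MolState → ℝ≥0∞} (hf : Measurable f) :
    ∫⁻ x, f x ∂stateMeasure = ∫⁻ v : Vel, ∫⁻ I in Ici (0 : ℝ), f (v, I) :=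
  lintegral_prod _ hf.aemeasurable

instance : SFinite stateMeasure := by unfold stateMeasure; infer_instance

theorem lintegral_comp_affine {lam : ℝ} (hlam : 0 < lam) (v₀ p : Vel) {f : Vel → ℝ≥0∞}
    (hf : Measurable f) :
    ∫⁻ v : Vel, f (lam • (v - v₀) + p) = ENNReal.ofReal ((lam ^ 3)⁻¹) * ∫⁻ v, f v := by
  rw [lintegral_sub_right_eq_self (fun v => f (lam • v + p)) v₀,
    lintegral_comp_smul_of_pos volume (f := fun v => f (v + p)) (by fun_prop) hlam,
    lintegral_add_right_eq_self]
  simp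

/-- For a fixed collision partner `(v₀, I₀)`, the collision map `(v, I) ↦ (v', I')` with parameters
`σ, r, R` has constant Jacobian `lam ^ 3 * κ`, because in the variables `(v, E)` it is
composed of dilations, a translation and a shear. At fixed `(v', I')` the vector `v - v₀` is parallel to a deflection of
`v' - v₀`, so that averaging over `σ` costs no more than the norm of the angular kernel. -/
theorem lintegral_collision_le {lam κ c m I₀ : ℝ} (hlam : 0 < lam) (hκ : 0 < κ) (hc : 0 ≤ c)
    (hm : 0 ≤ m) (hI₀ : 0 ≤ I₀) (v₀ : Vel) {h : ℝ → ℝ≥0∞} (hh : Measurable h)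
    (hsupp : ∀ t < 0, h t = 0) {X : MolState → ℝ≥0∞} (hX : Measurable X) :
    ∫⁻ σ : Dir, (∫⁻ z, h (inner ℝ (‖z.1 - v₀‖⁻¹ • (z.1 - v₀)) (σ : Vel)) *
        X (lam • (z.1 - v₀) + (v₀ + (c * √(m * ‖z.1 - v₀‖ ^ 2 + z.2 + I₀)) • (σ : Vel)),
          κ * (m * ‖z.1 - v₀‖ ^ 2 + z.2 + I₀)) ∂stateMeasure) ∂(volume : Measure Vel).toSphere
      ≤ ENNReal.ofReal ((lam ^ 3 * κ)⁻¹) *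
        (ENNReal.ofReal (2 * Real.pi) * ∫⁻ t in Icc (-1 : ℝ) 1, h t) * ∫⁻ z, X z ∂stateMeasure := by
  -- At fixed `σ`, the energy `E` replaces `I`, and then `v'` replaces `v`.
  have hσ : ∀ σ : Dir, ∫⁻ z, h (inner ℝ (‖z.1 - v₀‖⁻¹ • (z.1 - v₀)) (σ : Vel)) *
        X (lam • (z.1 - v₀) + (v₀ + (c * √(m * ‖z.1 - v₀‖ ^ 2 + z.2 + I₀)) • (σ : Vel)),
          κ * (m * ‖z.1 - v₀‖ ^ 2 + z.2 + I₀)) ∂stateMeasure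
      ≤ ENNReal.ofReal ((lam ^ 3)⁻¹) * ∫⁻ E in Ici (0 : ℝ), ∫⁻ v : Vel,
        h (inner ℝ (‖v - v₀ - (c * √E) • (σ : Vel)‖⁻¹ • (v - v₀ - (c * √E) • (σ : Vel)))
          (σ : Vel)) * X (v, κ * E) := by
    intro σ
    rw [lintegral_stateMeasure (by fun_prop), ← lintegral_const_mul _ (by fun_prop)]
    calc _ ≤ ∫⁻ v : Vel, ∫⁻ E in Ici (0 : ℝ),
            h (inner ℝ (‖v - v₀‖⁻¹ • (v - v₀)) (σ : Vel)) *
              X (lam • (v - v₀) + (v₀ + (c * √E) • (σ : Vel)), κ * E) := by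
          refine lintegral_mono fun v => ?_
          have := setLIntegral_Ici_comp_add_le (b := m * ‖v - v₀‖ ^ 2 + I₀) (by positivity)
            (fun E => h (inner ℝ (‖v - v₀‖⁻¹ • (v - v₀)) (σ : Vel)) *
              X (lam • (v - v₀) + (v₀ + (c * √E) • (σ : Vel)), κ * E))
          refine le_of_eq_of_le (lintegral_congr fun I => ?_) this
          rw [show m * ‖v - v₀‖ ^ 2 + I + I₀ = I + (m * ‖v - v₀‖ ^ 2 + I₀) by ring]
      _ = ∫⁻ E in Ici (0 : ℝ), ∫⁻ v : Vel, h (inner ℝ (‖v - v₀‖⁻¹ • (v - v₀)) (σ : Vel)) *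
              X (lam • (v - v₀) + (v₀ + (c * √E) • (σ : Vel)), κ * E) :=
          lintegral_lintegral_swap (Measurable.aemeasurable (by fun_prop))
      _ = _ := by
          refine lintegral_congr fun E => ?_
          rw [← lintegral_comp_affine hlam v₀ (v₀ + (c * √E) • (σ : Vel)) (by fun_prop)]
          refine lintegral_congr fun v => ?_
          have h1 : lam • (v - v₀) + (v₀ + (c * √E) • (σ : Vel)) - v₀ - (c * √E) • (σ : Vel)
              = lam • (v - v₀) := by abel
          have h2 : ‖lam • (v - v₀)‖⁻¹ • lam • (v - v₀) = ‖v - v₀‖⁻¹ • (v - v₀) := by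
            rw [norm_smul, Real.norm_of_nonneg hlam.le, smul_smul, mul_inv, mul_comm lam⁻¹,
              mul_assoc, inv_mul_cancel₀ hlam.ne', mul_one]
          rw [h1, h2]
  have hjac : ENNReal.ofReal ((lam ^ 3 * κ)⁻¹)
      = ENNReal.ofReal ((lam ^ 3)⁻¹) * ENNReal.ofReal κ⁻¹ := by
    rw [mul_inv, ENNReal.ofReal_mul (by positivity)]
  refine (lintegral_mono hσ).trans ?_
  rw [lintegral_const_mul _ (by fun_prop), hjac, mul_assoc, mul_assoc, mul_assoc]
  gcongr ENNReal.ofReal _ * ?_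
  rw [lintegral_lintegral_swap (Measurable.aemeasurable (by fun_prop))]
  calc _ ≤ ∫⁻ E in Ici (0 : ℝ), (ENNReal.ofReal (2 * Real.pi) * ∫⁻ t in Icc (-1 : ℝ) 1, h t) *
        ∫⁻ v : Vel, X (v, κ * E) := by
        refine lintegral_mono fun E => ?_
        rw [lintegral_lintegral_swap (Measurable.aemeasurable (by fun_prop)),
          ← lintegral_const_mul _ (by fun_prop)]
        have hne : ∀ᵐ v : Vel, v ≠ v₀ := by simp [ae_iff]
        refine lintegral_mono_ae ?_
        filter_upwards [hne] with v hv
        rw [lintegral_mul_const _ (by fun_prop)]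
        gcongr
        exact lintegral_sphere_deflected_le (sub_ne_zero.2 hv) (by positivity) hh hsupp
    _ = (ENNReal.ofReal (2 * Real.pi) * ∫⁻ t in Icc (-1 : ℝ) 1, h t) *
        (ENNReal.ofReal κ⁻¹ * ∫⁻ E in Ici (0 : ℝ), ∫⁻ v : Vel, X (v, E)) := by
        rw [lintegral_const_mul _ (by fun_prop),
          setLIntegral_Ici_comp_mul (f := fun E => ∫⁻ v : Vel, X (v, E)) hκ (by fun_prop)]
    _ = _ := by
        rw [lintegral_lintegral_swap (Measurable.aemeasurable (by fun_prop)),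
          lintegral_stateMeasure hX]
        ring

/-! ### Hölder's inequality for the collision map -/

theorem lintegral_mul_le_eLpNorm_mul_eLpNorm {α : Type*} [MeasurableSpace α] (ν : Measure α)
    {p q : ℝ≥0∞} (hpq : p.HolderConjugate q) {F X : α → ℝ≥0∞} (hF : AEMeasurable F ν)
    (hX : AEMeasurable X ν) : ∫⁻ x, F x * X x ∂ν ≤ eLpNorm F p ν * eLpNorm X q ν := by
  have key : ∀ {F X : α → ℝ≥0∞}, AEMeasurable X ν →
      ∫⁻ x, F x * X x ∂ν ≤ eLpNorm F ∞ ν * eLpNorm X 1 ν := by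
    intro F X hX
    rw [eLpNorm_one_eq_lintegral_enorm, eLpNorm_exponent_top, ← lintegral_const_mul'' _ (by simpa)]
    refine lintegral_mono_ae ?_
    filter_upwards [ae_le_eLpNormEssSup (f := F) (μ := ν)] with x hx
    gcongr
    · simpa using hx
    · simp
  have hinv := hpq.inv_add_inv_eq_inv
  by_cases hp : p = ∞
  · have hq : q = 1 := by simpa [hp] using hinv
    rw [hp, hq]
    exact key hX
  by_cases hq : q = ∞
  · have hp : p = 1 := by simpa [hq] using hinv
    rw [hp, hq, mul_comm]
    simp_rw [mul_comm (F _)]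
    exact key hF
  have := hpq
  have hr := ENNReal.HolderConjugate.toReal_of_ne_top hp hq
  have hp0 : p ≠ 0 := by
    rintro rfl
    simpa using hr.pos
  have hq0 : q ≠ 0 := by
    rintro rfl
    simpa using hr.symm.pos
  rw [eLpNorm_eq_lintegral_rpow_enorm_toReal hp0 hp, eLpNorm_eq_lintegral_rpow_enorm_toReal hq0 hq]
  simpa using ENNReal.lintegral_mul_le_Lp_mul_Lq ν hr hF hX

/-- Hölder's inequality for functions composed with two maps under which the image of `ν` is
bounded by a multiple of `μ`. -/
theorem lintegral_mul_comp_le {α β : Type*} [MeasurableSpace α] [MeasurableSpace β]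
    {ν : Measure α} {μ : Measure β} {p q : ℝ≥0∞} (hpq : p.HolderConjugate q) {A D : ℝ≥0∞}
    {ψ φ : α → β} (hψ : Measurable ψ) (hφ : Measurable φ) (hA : ν.map ψ ≤ A • μ)
    (hD : ν.map φ ≤ D • μ) {F X : β → ℝ≥0∞} (hF : Measurable F) (hX : Measurable X) :
    ∫⁻ x, F (ψ x) * X (φ x) ∂ν
      ≤ A ^ p⁻¹.toReal * eLpNorm F p μ * (D ^ q⁻¹.toReal * eLpNorm X q μ) := by
  refine (lintegral_mul_le_eLpNorm_mul_eLpNorm ν hpq (hF.comp hψ).aemeasurable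
    (hX.comp hφ).aemeasurable).trans ?_
  gcongr
  · rw [← one_div, ← smul_eq_mul, ← eLpNorm_map_measure hF.aestronglyMeasurable hψ.aemeasurable]
    exact (eLpNorm_mono_measure _ hA).trans (eLpNorm_smul_measure_le A F p μ)
  · rw [← one_div, ← smul_eq_mul, ← eLpNorm_map_measure hX.aestronglyMeasurable hφ.aemeasurable]
    exact (eLpNorm_mono_measure _ hD).trans (eLpNorm_smul_measure_le D X q μ)

theorem map_withDensity_le_of_lintegral_le {α β : Type*} [MeasurableSpace α] [MeasurableSpace β]
    {ν : Measure α} {μ : Measure β} {w : α → ℝ≥0∞} (hw : Measurable w) {φ : α → β}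
    (hφ : Measurable φ) {D : ℝ≥0∞}
    (h : ∀ X : β → ℝ≥0∞, Measurable X → ∫⁻ x, w x * X (φ x) ∂ν ≤ D * ∫⁻ y, X y ∂μ) :
    (ν.withDensity w).map φ ≤ D • μ := by
  refine Measure.le_intro fun s hs _ => ?_
  have h1 := h (s.indicator 1) (measurable_one.indicator hs)
  rw [← lintegral_indicator_one hs, lintegral_map (measurable_one.indicator hs) hφ,
    lintegral_withDensity_eq_lintegral_mul (g := fun x => s.indicator 1 (φ x)) _ hw
      ((measurable_one.indicator hs).comp hφ),
    Measure.smul_apply, smul_eq_mul, ← lintegral_indicator_one hs]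
  exact h1

theorem toReal_inv_add_toReal_inv {p q : ℝ≥0∞} (hpq : p.HolderConjugate q) :
    p⁻¹.toReal + q⁻¹.toReal = 1 := by
  have hinv := hpq.inv_add_inv_eq_inv
  have hp1 : p⁻¹ ≠ ∞ := ne_top_of_le_ne_top ENNReal.one_ne_top (by
    rw [inv_one] at hinv; exact hinv ▸ le_self_add)
  have hq1 : q⁻¹ ≠ ∞ := ne_top_of_le_ne_top ENNReal.one_ne_top (by
    rw [inv_one] at hinv; exact hinv ▸ le_add_self)
  rw [← ENNReal.toReal_add hp1 hq1, hinv]; simp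

/-- Hölder's inequality for the collision map with a fixed partner, with respect to the measure
`h(û · σ) dσ dv dI`. Its image under `(σ, v, I) ↦ (v, I)` has density at most the norm of `h`, and
its image under `(σ, v, I) ↦ (v', I')` at most that norm divided by the Jacobian, so that the norm
of `h` enters with the exponent `1/p + 1/q = 1`, and the Jacobian with the exponent `-1/q`. -/
theorem lintegral_mul_collision_le {p q : ℝ≥0∞} (hpq : p.HolderConjugate q) {lam κ c m I₀ : ℝ}
    (hlam : 0 < lam) (hκ : 0 < κ) (hc : 0 ≤ c)
    (hm : 0 ≤ m) (hI₀ : 0 ≤ I₀) (v₀ : Vel) {h : ℝ → ℝ≥0∞} (hh : Measurable h)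
    (hsupp : ∀ t < 0, h t = 0) {F X : MolState → ℝ≥0∞} (hF : Measurable F) (hX : Measurable X) :
    ∫⁻ σ : Dir, (∫⁻ z, h (inner ℝ (‖z.1 - v₀‖⁻¹ • (z.1 - v₀)) (σ : Vel)) * (F z *
        X (lam • (z.1 - v₀) + (v₀ + (c * √(m * ‖z.1 - v₀‖ ^ 2 + z.2 + I₀)) • (σ : Vel)),
          κ * (m * ‖z.1 - v₀‖ ^ 2 + z.2 + I₀))) ∂stateMeasure) ∂(volume : Measure Vel).toSphere
      ≤ ENNReal.ofReal ((lam ^ 3 * κ)⁻¹ ^ q⁻¹.toReal) *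
        (ENNReal.ofReal (2 * Real.pi) * ∫⁻ t in Icc (-1 : ℝ) 1, h t) *
          eLpNorm F p stateMeasure * eLpNorm X q stateMeasure := by
  obtain ⟨N, hN⟩ : ∃ N, N = ENNReal.ofReal (2 * Real.pi) * ∫⁻ t in Icc (-1 : ℝ) 1, h t := ⟨_, rfl⟩
  rw [← hN]
  let w : Dir × MolState → ℝ≥0∞ := fun y =>
    h (inner ℝ (‖y.2.1 - v₀‖⁻¹ • (y.2.1 - v₀)) (y.1 : Vel))
  let φ : Dir × MolState → MolState := fun y =>
    (lam • (y.2.1 - v₀) + (v₀ + (c * √(m * ‖y.2.1 - v₀‖ ^ 2 + y.2.2 + I₀)) • (y.1 : Vel)),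
          κ * (m * ‖y.2.1 - v₀‖ ^ 2 + y.2.2 + I₀))
  have hw : Measurable w := by fun_prop
  have hφ : Measurable φ := by fun_prop
  set ν := (volume : Measure Vel).toSphere.prod stateMeasure
  have hA : (ν.withDensity w).map Prod.snd ≤ N • stateMeasure := by
    refine map_withDensity_le_of_lintegral_le hw measurable_snd fun Y hY => ?_
    rw [lintegral_prod_symm _ (by fun_prop), ← lintegral_const_mul _ hY]
    refine lintegral_mono_ae ?_
    have hne : ∀ᵐ z ∂stateMeasure, z.1 ≠ v₀ := by
      refine Measure.quasiMeasurePreserving_fst.ae (p := fun v : Vel => v ≠ v₀) ?_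
      simp [ae_iff]
    filter_upwards [hne] with z hz
    rw [lintegral_mul_const _ (by fun_prop)]
    gcongr
    have := lintegral_sphere_deflected_le (sub_ne_zero.2 hz) le_rfl hh hsupp
    simpa only [w, zero_smul, sub_zero, hN] using this
  have hD : (ν.withDensity w).map φ ≤ (ENNReal.ofReal ((lam ^ 3 * κ)⁻¹) * N) • stateMeasure := by
    refine map_withDensity_le_of_lintegral_le hw hφ fun Y hY => ?_
    rw [lintegral_prod _ (by fun_prop), hN]
    exact lintegral_collision_le hlam hκ hc hm hI₀ v₀ hh hsupp hY
  have h1 := lintegral_mul_comp_le hpq measurable_snd hφ hA hD hF hX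
  rw [lintegral_withDensity_eq_lintegral_mul _ hw (by fun_prop),
    lintegral_prod _ (Measurable.aemeasurable (hw.mul (by fun_prop)))] at h1
  refine h1.trans (le_of_eq ?_)
  have hsum := toReal_inv_add_toReal_inv hpq
  rw [ENNReal.mul_rpow_of_nonneg _ _ ENNReal.toReal_nonneg,
    ENNReal.ofReal_rpow_of_nonneg (by positivity) ENNReal.toReal_nonneg]
  have hNN : N ^ p⁻¹.toReal * N ^ q⁻¹.toReal = N := by
    rw [← ENNReal.rpow_add_of_nonneg _ _ ENNReal.toReal_nonneg ENNReal.toReal_nonneg, hsum,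
      ENNReal.rpow_one]
  calc _ = ENNReal.ofReal ((lam ^ 3 * κ)⁻¹ ^ q⁻¹.toReal) * (N ^ p⁻¹.toReal * N ^ q⁻¹.toReal) *
          eLpNorm F p stateMeasure * eLpNorm X q stateMeasure := by ring
    _ = _ := by rw [hNN]

/-! ### Energy estimates -/

namespace Mixture

theorem totalMass_pos {P : ℕ} (M : Mixture P) (i : Fin P) : 0 < M.totalMass :=
  (M.mass_pos i).trans_le
    (Finset.single_le_sum (f := M.mass) (fun l _ => (M.mass_pos l).le) (Finset.mem_univ i))

variable {P : ℕ} (M : Mixture P) (i j : Fin P)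

theorem reducedMass_pos : 0 < M.reducedMass i j := by
  have := M.mass_pos i
  have := M.mass_pos j
  unfold reducedMass
  positivity

theorem minRatio_pos : 0 < M.minRatio i j := by
  have := M.mass_pos i
  have := M.mass_pos j
  exact lt_min (by positivity) (by positivity)

theorem minRatio_le_left : M.minRatio i j ≤ M.mass i / (M.mass i + M.mass j) := min_le_left _ _

theorem minRatio_le_right : M.minRatio i j ≤ M.mass j / (M.mass i + M.mass j) := min_le_right _ _

theorem minRatio_le_half : M.minRatio i j ≤ 1 / 2 := by
  have hi := M.mass_pos i
  have hj := M.mass_pos j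
  have h : M.mass i / (M.mass i + M.mass j) + M.mass j / (M.mass i + M.mass j) = 1 := by
    field_simp
  linarith [M.minRatio_le_left i j, M.minRatio_le_right i j]

theorem energy_nonneg {x y : MolState} (hx : 0 ≤ x.2) (hy : 0 ≤ y.2) : 0 ≤ M.energy i j x y := by
  have := M.reducedMass_pos i j
  unfold energy
  positivity

theorem bracket_sq {x : MolState} (hx : 0 ≤ x.2) : M.bracket i x ^ 2
    = 1 + M.mass i / (2 * M.totalMass) * ‖x.1‖ ^ 2 + x.2 / M.totalMass := by
  have := M.mass_pos i
  have := M.totalMass_pos i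
  exact Real.sq_sqrt (by positivity)

theorem one_le_bracket {x : MolState} (hx : 0 ≤ x.2) : 1 ≤ M.bracket i x := by
  have := M.mass_pos i
  have := M.totalMass_pos i
  refine Real.one_le_sqrt.2 ?_
  have : 0 ≤ M.mass i / (2 * M.totalMass) * ‖x.1‖ ^ 2 + x.2 / M.totalMass := by positivity
  linarith

/-- The kinetic energy splits into that of the center of mass and that of the relative motion. -/
theorem kinetic_add_kinetic (V u : Vel) :
    M.mass i * ‖V + (M.mass j / (M.mass i + M.mass j)) • u‖ ^ 2
      + M.mass j * ‖V - (M.mass i / (M.mass i + M.mass j)) • u‖ ^ 2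
    = (M.mass i + M.mass j) * ‖V‖ ^ 2 + M.reducedMass i j * ‖u‖ ^ 2 := by
  have hi := M.mass_pos i
  have hj := M.mass_pos j
  rw [norm_add_sq_real, norm_sub_sq_real, norm_smul, norm_smul, inner_smul_right, inner_smul_right,
    Real.norm_of_nonneg (by positivity), Real.norm_of_nonneg (by positivity), reducedMass]
  field_simp
  ring

theorem centerVel_add (v w : Vel) :
    M.centerVel i j v w + (M.mass j / (M.mass i + M.mass j)) • (v - w) = v := by
  have hi := M.mass_pos i
  have hj := M.mass_pos j
  have h : M.mass i + M.mass j ≠ 0 := by positivity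
  simp only [centerVel, smul_add, smul_smul, smul_sub, div_eq_inv_mul]
  have : v = ((M.mass i + M.mass j)⁻¹ * M.mass i + (M.mass i + M.mass j)⁻¹ * M.mass j) • v := by
    rw [← mul_add, inv_mul_cancel₀ h, one_smul]
  conv_rhs => rw [this, add_smul]
  abel

theorem centerVel_sub (v w : Vel) :
    M.centerVel i j v w - (M.mass i / (M.mass i + M.mass j)) • (v - w) = w := by
  have hi := M.mass_pos i
  have hj := M.mass_pos j
  have h : M.mass i + M.mass j ≠ 0 := by positivity
  simp only [centerVel, smul_add, smul_smul, smul_sub, div_eq_inv_mul]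
  have : w = ((M.mass i + M.mass j)⁻¹ * M.mass i + (M.mass i + M.mass j)⁻¹ * M.mass j) • w := by
    rw [← mul_add, inv_mul_cancel₀ h, one_smul]
  conv_rhs => rw [this, add_smul]
  abel

theorem kinetic_add_kinetic_eq (v w : Vel) : M.mass i * ‖v‖ ^ 2 + M.mass j * ‖w‖ ^ 2
    = (M.mass i + M.mass j) * ‖M.centerVel i j v w‖ ^ 2 + M.reducedMass i j * ‖v - w‖ ^ 2 := by
  rw [← M.kinetic_add_kinetic, centerVel_add, centerVel_sub]

theorem norm_sq_relative {x y : MolState} (hx : 0 ≤ x.2) (hy : 0 ≤ y.2) {R : ℝ} (hR : 0 ≤ R)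
    (σ : Dir) : ‖√(2 * R * M.energy i j x y / M.reducedMass i j) • (σ : Vel)‖ ^ 2
      = 2 * R * M.energy i j x y / M.reducedMass i j := by
  have hE := M.energy_nonneg i j hx hy
  have := M.reducedMass_pos i j
  rw [norm_smul, mul_pow, Real.norm_eq_abs, sq_abs, Real.sq_sqrt (by positivity)]
  simp

theorem energy_le_bracket_mul {x y : MolState} (hx : 0 ≤ x.2) (hy : 0 ≤ y.2) :
    M.energy i j x y / M.totalMass ≤ (M.bracket i x * M.bracket j y) ^ 2 := by
  have hi := M.mass_pos i
  have hj := M.mass_pos j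
  have hm := M.totalMass_pos i
  have h := M.kinetic_add_kinetic_eq i j x.1 y.1
  have h0 : 0 ≤ (M.mass i + M.mass j) * ‖M.centerVel i j x.1 y.1‖ ^ 2 := by positivity
  have h1 : M.energy i j x y / M.totalMass ≤
      (M.mass i / (2 * M.totalMass) * ‖x.1‖ ^ 2 + x.2 / M.totalMass) +
      (M.mass j / (2 * M.totalMass) * ‖y.1‖ ^ 2 + y.2 / M.totalMass) := by
    rw [energy, div_le_iff₀ hm]
    field_simp
    linarith
  rw [mul_pow, M.bracket_sq i hx, M.bracket_sq j hy]
  have h2 : 0 ≤ M.mass i / (2 * M.totalMass) * ‖x.1‖ ^ 2 + x.2 / M.totalMass := by positivity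
  have h3 : 0 ≤ M.mass j / (2 * M.totalMass) * ‖y.1‖ ^ 2 + y.2 / M.totalMass := by positivity
  nlinarith [mul_nonneg h2 h3]

theorem primed_snd_nonneg {x y : MolState} {c : CollParam} (hx : 0 ≤ x.2) (hy : 0 ≤ y.2)
    (hr : c.2.1 ∈ Icc (0 : ℝ) 1) (hR : c.2.2 ∈ Icc (0 : ℝ) 1) : 0 ≤ (M.primed i j x y c).2 :=
  mul_nonneg (mul_nonneg hr.1 (sub_nonneg.2 hR.2)) (M.energy_nonneg i j hx hy)

theorem bracket_primed_le {x y : MolState} {c : CollParam} (hx : 0 ≤ x.2) (hy : 0 ≤ y.2)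
    (hr : c.2.1 ∈ Icc (0 : ℝ) 1) (hR : c.2.2 ∈ Icc (0 : ℝ) 1) :
    M.bracket i (M.primed i j x y c) ^ 2 ≤ (M.bracket i x * M.bracket j y) ^ 2 := by
  have hi := M.mass_pos i
  have hj := M.mass_pos j
  have hm := M.totalMass_pos i
  have hμ := M.reducedMass_pos i j
  have hE := M.energy_nonneg i j hx hy
  have h := M.kinetic_add_kinetic_eq i j x.1 y.1
  have h' := M.kinetic_add_kinetic i j (M.centerVel i j x.1 y.1)
    (√(2 * c.2.2 * M.energy i j x y / M.reducedMass i j) • (c.1 : Vel))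
  rw [M.norm_sq_relative i j hx hy hR.1, smul_smul, mul_div_cancel₀ _ hμ.ne'] at h'
  have h4 : M.mass i * ‖(M.primed i j x y c).1‖ ^ 2 ≤
      (M.mass i + M.mass j) * ‖M.centerVel i j x.1 y.1‖ ^ 2 + 2 * c.2.2 * M.energy i j x y := by
    rw [← h']
    exact le_add_of_nonneg_right (by positivity)
  have h5 : (M.primed i j x y c).2 ≤ (1 - c.2.2) * M.energy i j x y := by
    have : 0 ≤ (1 - c.2.2) * M.energy i j x y := mul_nonneg (sub_nonneg.2 hR.2) hE
    simp only [primed, mul_assoc]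
    exact mul_le_of_le_one_left this hr.2
  have h1 : M.mass i / (2 * M.totalMass) * ‖(M.primed i j x y c).1‖ ^ 2
        + (M.primed i j x y c).2 / M.totalMass ≤
      (M.mass i / (2 * M.totalMass) * ‖x.1‖ ^ 2 + x.2 / M.totalMass) +
      (M.mass j / (2 * M.totalMass) * ‖y.1‖ ^ 2 + y.2 / M.totalMass) := by
    have hEdef : M.energy i j x y = M.reducedMass i j / 2 * ‖x.1 - y.1‖ ^ 2 + x.2 + y.2 := rfl
    field_simp
    nlinarith
  rw [mul_pow, M.bracket_sq i hx, M.bracket_sq j hy,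
    M.bracket_sq i (M.primed_snd_nonneg i j hx hy hr hR)]
  have h2 : 0 ≤ M.mass i / (2 * M.totalMass) * ‖x.1‖ ^ 2 + x.2 / M.totalMass := by positivity
  have h3 : 0 ≤ M.mass j / (2 * M.totalMass) * ‖y.1‖ ^ 2 + y.2 / M.totalMass := by positivity
  nlinarith [mul_nonneg h2 h3]

theorem norm_sq_le_norm_add_sq {u w : Vel} (h : 0 ≤ inner ℝ u w) : ‖w‖ ^ 2 ≤ ‖u + w‖ ^ 2 := by
  rw [norm_add_sq_real]
  nlinarith [sq_nonneg ‖u‖]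

theorem primed_fst_eq (x y : MolState) (c : CollParam) : (M.primed i j x y c).1
    = (M.mass i / (M.mass i + M.mass j)) • (x.1 - y.1) + (y.1 + (M.mass j / (M.mass i + M.mass j)
      * √(2 * c.2.2 * M.energy i j x y / M.reducedMass i j)) • (c.1 : Vel)) := by
  have h := M.centerVel_sub i j x.1 y.1
  rw [sub_eq_iff_eq_add'] at h
  rw [primed, ← add_assoc, ← h]

theorem primed_fst_eq' (x y : MolState) (c : CollParam) : (M.primed i j x y c).1
    = (M.mass j / (M.mass i + M.mass j)) • (y.1 - x.1) + (x.1 + (M.mass j / (M.mass i + M.mass j)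
      * √(2 * c.2.2 * M.energy i j x y / M.reducedMass i j)) • (c.1 : Vel)) := by
  have h := M.centerVel_add i j x.1 y.1
  rw [← eq_sub_iff_add_eq] at h
  rw [primed, ← add_assoc, ← neg_sub x.1 y.1, smul_neg, neg_add_eq_sub, h]

/-- When the relative velocity and the scattering direction form an acute angle, the energy is
controlled by the outgoing first and the incoming second molecule. -/
theorem energy_le_of_inner_nonneg {x y : MolState} {c : CollParam} (hx : 0 ≤ x.2) (hy : 0 ≤ y.2)
    (hr : c.2.1 ∈ Icc (0 : ℝ) 1) (hR : c.2.2 ∈ Icc (0 : ℝ) 1)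
    (hu : 0 ≤ inner ℝ (x.1 - y.1) (c.1 : Vel)) :
    M.minRatio i j ^ 2 * c.2.1 * (M.energy i j x y / M.totalMass)
      ≤ (M.bracket i (M.primed i j x y c) * M.bracket j y) ^ 2 := by
  have hi := M.mass_pos i
  have hj := M.mass_pos j
  have hm := M.totalMass_pos i
  have hμ := M.reducedMass_pos i j
  have hE := M.energy_nonneg i j hx hy
  have hs := M.minRatio_pos i j
  have hI' := M.primed_snd_nonneg i j hx hy hr hR
  set x' := M.primed i j x y c with hx'
  set E := M.energy i j x y with hEd
  have h := M.kinetic_add_kinetic_eq i j x'.1 y.1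
  have h0 : 0 ≤ (M.mass i + M.mass j) * ‖M.centerVel i j x'.1 y.1‖ ^ 2 := by positivity
  have hrel : (M.mass j / (M.mass i + M.mass j)) ^ 2 * (2 * c.2.2 * E / M.reducedMass i j)
      ≤ ‖x'.1 - y.1‖ ^ 2 := by
    rw [hx', primed_fst_eq]
    have : ∀ a b : Vel, a + (y.1 + b) - y.1 = a + b := fun a b => by abel
    rw [this]
    refine le_trans (le_of_eq ?_) (norm_sq_le_norm_add_sq ?_)
    · rw [mul_smul, norm_smul _ (√_ • (c.1 : Vel)), mul_pow, Real.norm_eq_abs, sq_abs,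
        M.norm_sq_relative i j hx hy hR.1]
    · rw [real_inner_smul_left, real_inner_smul_right]
      positivity
  have h1 : M.minRatio i j ^ 2 * c.2.2 * E ≤ M.reducedMass i j / 2 * ‖x'.1 - y.1‖ ^ 2 := by
    calc M.minRatio i j ^ 2 * c.2.2 * E
        ≤ (M.mass j / (M.mass i + M.mass j)) ^ 2 * c.2.2 * E := by
          have := hR.1
          gcongr
          exact M.minRatio_le_right i j
      _ = M.reducedMass i j / 2 * ((M.mass j / (M.mass i + M.mass j)) ^ 2 *
          (2 * c.2.2 * E / M.reducedMass i j)) := by field_simp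
      _ ≤ _ := by gcongr
  have hI'eq : x'.2 = c.2.1 * (1 - c.2.2) * E := rfl
  have hs1 : M.minRatio i j ^ 2 ≤ 1 := by nlinarith [M.minRatio_le_half i j]
  -- `r ≤ R + r (1 - R)`
  have h2 : M.minRatio i j ^ 2 * c.2.1 * E ≤ M.minRatio i j ^ 2 * c.2.2 * E + x'.2 := by
    rw [hI'eq]
    have e1 : 0 ≤ (1 - M.minRatio i j ^ 2) * (c.2.1 * (1 - c.2.2) * E) :=
      mul_nonneg (sub_nonneg.2 hs1) (hI'eq ▸ hI')
    have e2 : 0 ≤ M.minRatio i j ^ 2 * ((1 - c.2.1) * c.2.2) * E :=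
      mul_nonneg (mul_nonneg (sq_nonneg _) (mul_nonneg (sub_nonneg.2 hr.2) hR.1)) hE
    nlinarith
  have h3 : M.minRatio i j ^ 2 * c.2.1 * (E / M.totalMass) ≤
      (M.mass i / (2 * M.totalMass) * ‖x'.1‖ ^ 2 + x'.2 / M.totalMass) +
      (M.mass j / (2 * M.totalMass) * ‖y.1‖ ^ 2 + y.2 / M.totalMass) := by
    field_simp
    nlinarith
  rw [mul_pow, M.bracket_sq i hI', M.bracket_sq j hy]
  have h4 : 0 ≤ M.mass i / (2 * M.totalMass) * ‖x'.1‖ ^ 2 + x'.2 / M.totalMass := by positivity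
  have h5 : 0 ≤ M.mass j / (2 * M.totalMass) * ‖y.1‖ ^ 2 + y.2 / M.totalMass := by positivity
  nlinarith [mul_nonneg h4 h5]

/-- When the relative velocity and the scattering direction form an obtuse angle, the energy is
controlled by the outgoing and the incoming first molecule. -/
theorem energy_le_of_inner_nonpos {x y : MolState} {c : CollParam} (hx : 0 ≤ x.2) (hy : 0 ≤ y.2)
    (hr : c.2.1 ∈ Icc (0 : ℝ) 1) (hR : c.2.2 ∈ Icc (0 : ℝ) 1)
    (hu : inner ℝ (x.1 - y.1) (c.1 : Vel) ≤ 0) :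
    M.minRatio i j ^ 2 * c.2.1 * (M.energy i j x y / M.totalMass)
      ≤ (M.bracket i (M.primed i j x y c) * M.bracket i x) ^ 2 := by
  have hi := M.mass_pos i
  have hj := M.mass_pos j
  have hm := M.totalMass_pos i
  have hμ := M.reducedMass_pos i j
  have hE := M.energy_nonneg i j hx hy
  have hs := M.minRatio_pos i j
  have hI' := M.primed_snd_nonneg i j hx hy hr hR
  set x' := M.primed i j x y c with hx'
  set E := M.energy i j x y with hEd
  have hrel : (M.mass j / (M.mass i + M.mass j)) ^ 2 * (2 * c.2.2 * E / M.reducedMass i j)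
      ≤ ‖x'.1 - x.1‖ ^ 2 := by
    rw [hx', primed_fst_eq']
    have : ∀ a b : Vel, a + (x.1 + b) - x.1 = a + b := fun a b => by abel
    rw [this]
    refine le_trans (le_of_eq ?_) (norm_sq_le_norm_add_sq ?_)
    · rw [mul_smul, norm_smul _ (√_ • (c.1 : Vel)), mul_pow, Real.norm_eq_abs, sq_abs,
        M.norm_sq_relative i j hx hy hR.1]
    · rw [real_inner_smul_left, real_inner_smul_right, ← neg_sub, inner_neg_left]
      have := neg_nonneg.2 hu
      positivity
  have hpar : ‖x'.1 - x.1‖ ^ 2 ≤ 2 * (‖x'.1‖ ^ 2 + ‖x.1‖ ^ 2) := by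
    have := norm_sub_le x'.1 x.1
    nlinarith [norm_nonneg (x'.1 - x.1), sq_nonneg (‖x'.1‖ - ‖x.1‖)]
  have h1 : M.minRatio i j ^ 2 * c.2.2 * E ≤ M.mass i / 2 * (‖x'.1‖ ^ 2 + ‖x.1‖ ^ 2) := by
    have hR0 := hR.1
    calc M.minRatio i j ^ 2 * c.2.2 * E
        ≤ 1 / 2 * (M.mass j / (M.mass i + M.mass j)) * c.2.2 * E := by
          gcongr
          rw [sq]
          exact mul_le_mul (M.minRatio_le_half i j) (M.minRatio_le_right i j) hs.le (by norm_num)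
      _ = M.mass i / 4 * ((M.mass j / (M.mass i + M.mass j)) ^ 2 *
          (2 * c.2.2 * E / M.reducedMass i j)) := by
          rw [reducedMass]
          field_simp
          ring
      _ ≤ M.mass i / 4 * (2 * (‖x'.1‖ ^ 2 + ‖x.1‖ ^ 2)) := by
          gcongr M.mass i / 4 * ?_
          exact hrel.trans hpar
      _ = _ := by ring
  have hI'eq : x'.2 = c.2.1 * (1 - c.2.2) * E := rfl
  have hs1 : M.minRatio i j ^ 2 ≤ 1 := by nlinarith [M.minRatio_le_half i j]
  -- `r ≤ R + r (1 - R)`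
  have h2 : M.minRatio i j ^ 2 * c.2.1 * E ≤ M.minRatio i j ^ 2 * c.2.2 * E + x'.2 := by
    rw [hI'eq]
    have e1 : 0 ≤ (1 - M.minRatio i j ^ 2) * (c.2.1 * (1 - c.2.2) * E) :=
      mul_nonneg (sub_nonneg.2 hs1) (hI'eq ▸ hI')
    have e2 : 0 ≤ M.minRatio i j ^ 2 * ((1 - c.2.1) * c.2.2) * E :=
      mul_nonneg (mul_nonneg (sq_nonneg _) (mul_nonneg (sub_nonneg.2 hr.2) hR.1)) hE
    nlinarith
  have h3 : M.minRatio i j ^ 2 * c.2.1 * (E / M.totalMass) ≤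
      (M.mass i / (2 * M.totalMass) * ‖x'.1‖ ^ 2 + x'.2 / M.totalMass) +
      (M.mass i / (2 * M.totalMass) * ‖x.1‖ ^ 2 + x.2 / M.totalMass) := by
    field_simp
    nlinarith
  rw [mul_pow, M.bracket_sq i hI', M.bracket_sq i hx]
  have h4 : 0 ≤ M.mass i / (2 * M.totalMass) * ‖x'.1‖ ^ 2 + x'.2 / M.totalMass := by positivity
  have h5 : 0 ≤ M.mass i / (2 * M.totalMass) * ‖x.1‖ ^ 2 + x.2 / M.totalMass := by positivity
  nlinarith [mul_nonneg h4 h5]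

end Mixture

/-- Distribution of the weights: `a, b, a'` stand for the Lebesgue brackets of the two incoming
molecules and of the outgoing one, `e` for the energy. The left-hand side is split into its powers
with exponents `s` and `t`; the first is bounded by `a, b`, the second by `a', b`. -/
theorem rpow_mul_rpow_le_weights {a b a' e d k γ s t : ℝ} (ha : 1 ≤ a) (hb : 1 ≤ b) (ha' : 1 ≤ a')
    (he : 0 ≤ e) (hd : 0 < d) (hk : 0 ≤ k) (hγ : 0 ≤ γ) (hs : 0 ≤ s) (ht : 0 ≤ t)
    (hst : s + t = 1) (h1 : e ≤ (a * b) ^ 2) (h2 : a' ^ 2 ≤ (a * b) ^ 2)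
    (h3 : d * e ≤ (a' * b) ^ 2) :
    a' ^ k * e ^ (γ / 2) ≤ a ^ ((k + γ) * s) * b ^ (k * s + γ) * a' ^ ((k + γ) * t)
      * d ^ (-(γ / 2 * t)) := by
  have ha0 : 0 < a := by linarith
  have hb0 : 0 < b := by linarith
  have ha'0 : 0 < a' := by linarith
  have hsq : ∀ x : ℝ, 0 ≤ x → (x ^ 2) ^ (γ / 2) = x ^ γ := by
    intro x hx
    rw [← Real.rpow_natCast, ← Real.rpow_mul hx]
    congr 1
    push_cast
    ring
  have f1 : a' ^ k ≤ a ^ k * b ^ k := by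
    rw [← Real.mul_rpow ha0.le hb0.le]
    exact Real.rpow_le_rpow ha'0.le (by nlinarith [mul_pos ha0 hb0]) hk
  have f2 : e ^ (γ / 2) ≤ a ^ γ * b ^ γ := by
    rw [← Real.mul_rpow ha0.le hb0.le, ← hsq _ (by positivity)]
    exact Real.rpow_le_rpow he h1 (by positivity)
  have f3 : e ^ (γ / 2) ≤ a' ^ γ * b ^ γ * d ^ (-(γ / 2)) := by
    rw [← Real.mul_rpow ha'0.le hb0.le, ← hsq _ (by positivity), Real.rpow_neg hd.le,
      ← div_eq_mul_inv, le_div_iff₀ (by positivity), ← Real.mul_rpow he hd.le, mul_comm e]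
    exact Real.rpow_le_rpow (by positivity) h3 (by positivity)
  have hL : 0 ≤ a' ^ k * e ^ (γ / 2) := by positivity
  calc a' ^ k * e ^ (γ / 2)
      = (a' ^ k * e ^ (γ / 2)) ^ s * (a' ^ k * e ^ (γ / 2)) ^ t := by
        rw [← Real.rpow_add_of_nonneg hL hs ht, hst, Real.rpow_one]
    _ ≤ (a ^ k * b ^ k * (a ^ γ * b ^ γ)) ^ s * (a' ^ k * (a' ^ γ * b ^ γ * d ^ (-(γ / 2)))) ^ t := by
        gcongr
    _ = (a ^ (k + γ) * b ^ (k + γ)) ^ s * (a' ^ (k + γ) * b ^ γ * d ^ (-(γ / 2))) ^ t := by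
        rw [Real.rpow_add ha0, Real.rpow_add hb0, Real.rpow_add ha'0]
        congr 2 <;> ring
    _ = a ^ ((k + γ) * s) * (b ^ ((k + γ) * s) * b ^ (γ * t)) * a' ^ ((k + γ) * t)
      * d ^ (-(γ / 2) * t) := by
        rw [Real.mul_rpow (by positivity) (by positivity),
          Real.mul_rpow (by positivity) (by positivity),
          Real.mul_rpow (by positivity) (by positivity), ← Real.rpow_mul ha0.le,
          ← Real.rpow_mul hb0.le, ← Real.rpow_mul hb0.le, ← Real.rpow_mul ha'0.le,
          ← Real.rpow_mul hd.le]
        ring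
    _ = _ := by
        rw [← Real.rpow_add hb0]
        congr 2
        · congr 2
          linear_combination γ * hst
        · ring

/-! ### The estimate of the weak form after the change of variables -/

instance : SFinite unitSquareMeasure := by unfold unitSquareMeasure; infer_instance

instance : SFinite paramMeasure := by unfold paramMeasure; infer_instance

theorem ae_stateMeasure_snd_pos : ∀ᵐ x ∂stateMeasure, 0 < x.2 := by
  refine Measure.quasiMeasurePreserving_snd.ae (p := fun t : ℝ => 0 < t) ?_
  rw [← restrict_Ioi_eq_restrict_Ici]
  exact ae_restrict_mem measurableSet_Ioi

theorem ae_unitSquareMeasure_mem :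
    ∀ᵐ s ∂unitSquareMeasure, s.1 ∈ Ioo (0 : ℝ) 1 ∧ s.2 ∈ Ioo (0 : ℝ) 1 := by
  have h : ∀ᵐ t ∂(volume.restrict (Icc (0 : ℝ) 1)), t ∈ Ioo (0 : ℝ) 1 := by
    rw [← restrict_Ioo_eq_restrict_Icc]
    exact ae_restrict_mem measurableSet_Ioo
  exact (Measure.quasiMeasurePreserving_fst.ae h).and (Measure.quasiMeasurePreserving_snd.ae h)

/-- The measure `dv dI dv_* dI_* dσ dr dR`. -/
def collMeasure : Measure (MolState × MolState × CollParam) :=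
  stateMeasure.prod (stateMeasure.prod paramMeasure)

theorem lintegral_paramMeasure {f : CollParam → ℝ≥0∞} (hf : Measurable f) :
    ∫⁻ c, f c ∂paramMeasure
      = ∫⁻ s, ∫⁻ σ : Dir, f (σ, s) ∂(volume : Measure Vel).toSphere ∂unitSquareMeasure :=
  lintegral_prod_symm _ hf.aemeasurable

theorem lintegral_collMeasure_left {Φ : MolState × MolState × CollParam → ℝ≥0∞}
    (hΦ : Measurable Φ) : ∫⁻ z, Φ z ∂collMeasure = ∫⁻ y, ∫⁻ s, ∫⁻ σ : Dir, ∫⁻ x, Φ (x, y, σ, s)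
      ∂stateMeasure ∂(volume : Measure Vel).toSphere ∂unitSquareMeasure ∂stateMeasure := by
  rw [collMeasure, lintegral_prod_symm _ hΦ.aemeasurable,
    lintegral_prod _ (Measurable.aemeasurable (by fun_prop))]
  exact lintegral_congr fun y => lintegral_paramMeasure (by fun_prop)

theorem lintegral_collMeasure_right {Φ : MolState × MolState × CollParam → ℝ≥0∞}
    (hΦ : Measurable Φ) : ∫⁻ z, Φ z ∂collMeasure = ∫⁻ x, ∫⁻ s, ∫⁻ σ : Dir, ∫⁻ y, Φ (x, y, σ, s)
      ∂stateMeasure ∂(volume : Measure Vel).toSphere ∂unitSquareMeasure ∂stateMeasure := by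
  rw [collMeasure, lintegral_prod _ hΦ.aemeasurable]
  refine lintegral_congr fun x => ?_
  rw [lintegral_prod_symm _ (Measurable.aemeasurable (by fun_prop))]
  exact lintegral_paramMeasure (by fun_prop)

/-- The norm of an angular kernel with values in `[0, ∞]`. -/
def angMass (h : ℝ → ℝ≥0∞) : ℝ≥0∞ :=
  ENNReal.ofReal (2 * Real.pi) * ∫⁻ t in Icc (-1 : ℝ) 1, h t

namespace Mixture

variable {P : ℕ} (M : Mixture P) (i j : Fin P)

@[fun_prop]
theorem measurable_energy {α : Type*} [MeasurableSpace α] {f g : α → MolState} (hf : Measurable f)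
    (hg : Measurable g) : Measurable fun a => M.energy i j (f a) (g a) := by
  unfold energy
  fun_prop

@[fun_prop]
theorem measurable_bracket {α : Type*} [MeasurableSpace α] {f : α → MolState} (hf : Measurable f) :
    Measurable fun a => M.bracket i (f a) := by
  unfold bracket
  fun_prop

@[fun_prop]
theorem measurable_primed {α : Type*} [MeasurableSpace α] {f g : α → MolState} {c : α → CollParam}
    (hf : Measurable f) (hg : Measurable g) (hc : Measurable c) :
    Measurable fun a => M.primed i j (f a) (g a) (c a) := by
  unfold primed centerVel
  fun_prop

@[fun_prop]
theorem measurable_primedStar {α : Type*} [MeasurableSpace α] {f g : α → MolState}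
    {c : α → CollParam} (hf : Measurable f) (hg : Measurable g) (hc : Measurable c) :
    Measurable fun a => M.primedStar i j (f a) (g a) (c a) := by
  unfold primedStar centerVel
  fun_prop

theorem sqrt_two_mul_energy {x y : MolState} {R : ℝ} (hR : 0 ≤ R) :
    √(2 * R * M.energy i j x y / M.reducedMass i j)
      = √(2 * R / M.reducedMass i j) * √(M.energy i j x y) := by
  have := M.reducedMass_pos i j
  rw [← Real.sqrt_mul (by positivity)]
  congr 1
  ring

theorem primed_eq_left (x y : MolState) (σ : Dir) {s : ℝ × ℝ} (hR : 0 ≤ s.2) :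
    M.primed i j x y (σ, s) = ((M.mass i / (M.mass i + M.mass j)) • (x.1 - y.1) + (y.1
      + ((M.mass j / (M.mass i + M.mass j) * √(2 * s.2 / M.reducedMass i j))
        * √(M.reducedMass i j / 2 * ‖x.1 - y.1‖ ^ 2 + x.2 + y.2)) • (σ : Vel)),
      s.1 * (1 - s.2) * (M.reducedMass i j / 2 * ‖x.1 - y.1‖ ^ 2 + x.2 + y.2)) := by
  refine Prod.ext ?_ rfl
  rw [M.primed_fst_eq, M.sqrt_two_mul_energy i j hR, ← mul_assoc]
  rfl

theorem primed_eq_right (x y : MolState) (σ : Dir) {s : ℝ × ℝ} (hR : 0 ≤ s.2) :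
    M.primed i j x y (σ, s) = ((M.mass j / (M.mass i + M.mass j)) • (y.1 - x.1) + (x.1
      + ((M.mass j / (M.mass i + M.mass j) * √(2 * s.2 / M.reducedMass i j))
        * √(M.reducedMass i j / 2 * ‖y.1 - x.1‖ ^ 2 + y.2 + x.2)) • (σ : Vel)),
      s.1 * (1 - s.2) * (M.reducedMass i j / 2 * ‖y.1 - x.1‖ ^ 2 + y.2 + x.2)) := by
  have h : M.reducedMass i j / 2 * ‖y.1 - x.1‖ ^ 2 + y.2 + x.2 = M.energy i j x y := by
    rw [energy, norm_sub_rev]; ring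
  refine Prod.ext ?_ ?_
  · rw [M.primed_fst_eq', M.sqrt_two_mul_energy i j hR, ← mul_assoc, h]
  · rw [h]; rfl

/-- The cosine `û · σ` of the scattering angle. -/
def cosAngle (x y : MolState) (σ : Dir) : ℝ := inner ℝ (‖x.1 - y.1‖⁻¹ • (x.1 - y.1)) (σ : Vel)

@[fun_prop]
theorem measurable_cosAngle {α : Type*} [MeasurableSpace α] {f g : α → MolState}
    {c : α → Dir} (hf : Measurable f) (hg : Measurable g) (hc : Measurable c) :
    Measurable fun a => cosAngle (f a) (g a) (c a) := by
  unfold cosAngle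
  fun_prop

theorem jacobian_rpow_le {lam : ℝ} (hlam : M.minRatio i j ≤ lam) {s : ℝ × ℝ}
    (hs : s.1 ∈ Ioo (0 : ℝ) 1 ∧ s.2 ∈ Ioo (0 : ℝ) 1) {t : ℝ} (ht : 0 ≤ t) :
    ENNReal.ofReal ((lam ^ 3 * (s.1 * (1 - s.2)))⁻¹ ^ t)
      ≤ ENNReal.ofReal (M.minRatio i j ^ (-(3 * t))) *
        ENNReal.ofReal (s.1 ^ (-t) * (1 - s.2) ^ (-t)) := by
  have h0 := M.minRatio_pos i j
  have h1 : 0 < lam := h0.trans_le hlam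
  have h2 := hs.1.1
  have h3 : 0 < 1 - s.2 := sub_pos.2 hs.2.2
  rw [← ENNReal.ofReal_mul (by positivity)]
  refine ENNReal.ofReal_le_ofReal ?_
  rw [Real.inv_rpow (by positivity), ← Real.rpow_neg (by positivity),
    Real.mul_rpow (by positivity) (by positivity), Real.mul_rpow h2.le h3.le]
  gcongr
  rw [← Real.rpow_natCast lam, ← Real.rpow_mul h1.le]
  push_cast
  rw [mul_neg]
  exact Real.rpow_le_rpow_of_nonpos h0 hlam (by simp [ht])

/-- The contribution of the forward part of the angular kernel: the second molecule is kept fixed,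
and Hölder's inequality is applied in the first one and in the scattering direction. -/
theorem lintegral_forward_le {p q : ℝ≥0∞} (hpq : p.HolderConjugate q) {F G X : MolState → ℝ≥0∞}
    (hF : Measurable F) (hG : Measurable G) (hX : Measurable X) {h : ℝ → ℝ≥0∞} (hh : Measurable h)
    (hsupp : ∀ t < 0, h t = 0) {β : ℝ × ℝ → ℝ≥0∞} (hβ : Measurable β) :
    ∫⁻ z, G z.2.1 * (β z.2.2.2 * (h (cosAngle z.1 z.2.1 z.2.2.1) *
        (F z.1 * X (M.primed i j z.1 z.2.1 z.2.2)))) ∂collMeasure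
      ≤ ENNReal.ofReal (M.minRatio i j ^ (-(3 * q⁻¹.toReal))) *
        (∫⁻ s, β s * ENNReal.ofReal (s.1 ^ (-q⁻¹.toReal) * (1 - s.2) ^ (-q⁻¹.toReal))
          ∂unitSquareMeasure) * (angMass h * (eLpNorm F p stateMeasure *
            eLpNorm G 1 stateMeasure) * eLpNorm X q stateMeasure) := by
  have hi := M.mass_pos i
  have hj := M.mass_pos j
  have hμ := M.reducedMass_pos i j
  set t := q⁻¹.toReal with ht
  set K := angMass h * (eLpNorm F p stateMeasure * eLpNorm X q stateMeasure) with hK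
  set J := ENNReal.ofReal (M.minRatio i j ^ (-(3 * t))) with hJ
  rw [lintegral_collMeasure_left (by fun_prop)]
  calc _ ≤ ∫⁻ y, G y * ((∫⁻ s, β s * ENNReal.ofReal (s.1 ^ (-t) * (1 - s.2) ^ (-t))
          ∂unitSquareMeasure) * (J * K)) ∂stateMeasure := by
        refine lintegral_mono_ae ?_
        filter_upwards [ae_stateMeasure_snd_pos] with y hy
        rw [← lintegral_mul_const _ (by fun_prop), ← lintegral_const_mul _ (by fun_prop)]
        refine lintegral_mono_ae ?_
        filter_upwards [ae_unitSquareMeasure_mem] with s hs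
        have h3 : 0 < 1 - s.2 := sub_pos.2 hs.2.2
        have h2 := hs.1.1
        have hkey := lintegral_mul_collision_le hpq
          (lam := M.mass i / (M.mass i + M.mass j)) (κ := s.1 * (1 - s.2))
          (c := M.mass j / (M.mass i + M.mass j) * √(2 * s.2 / M.reducedMass i j))
          (m := M.reducedMass i j / 2) (I₀ := y.2) (by positivity) (by positivity) (by positivity)
          (by positivity) hy.le y.1 hh hsupp hF hX
        simp_rw [← M.primed_eq_left i j _ y _ hs.2.1.le] at hkey
        have hin : ∀ σ : Dir, ∫⁻ x, G y * (β s * (h (cosAngle x y σ) *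
              (F x * X (M.primed i j x y (σ, s))))) ∂stateMeasure
            = G y * (β s * ∫⁻ x, h (cosAngle x y σ) *
              (F x * X (M.primed i j x y (σ, s))) ∂stateMeasure) := by
          intro σ
          rw [lintegral_const_mul _ (by fun_prop), lintegral_const_mul _ (by fun_prop)]
        simp only [hin]
        rw [lintegral_const_mul _ (by fun_prop), lintegral_const_mul _ (by fun_prop), mul_assoc]
        gcongr
        refine hkey.trans ?_
        calc _ ≤ (J * ENNReal.ofReal (s.1 ^ (-t) * (1 - s.2) ^ (-t))) * angMass h
                * eLpNorm F p stateMeasure * eLpNorm X q stateMeasure := by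
              gcongr
              · exact M.jacobian_rpow_le i j (M.minRatio_le_left i j) hs ENNReal.toReal_nonneg
              · rfl
          _ = _ := by rw [hK]; ring
    _ = _ := by
        rw [lintegral_mul_const _ hG, eLpNorm_one_eq_lintegral_enorm (f := G)]
        simp only [enorm_eq_self]
        rw [hK]
        ring

/-- The contribution of the backward part of the angular kernel: the first molecule is kept fixed,
and Hölder's inequality is applied in the second one and in the scattering direction. -/
theorem lintegral_backward_le {p q : ℝ≥0∞} (hpq : p.HolderConjugate q) {F G X : MolState → ℝ≥0∞}
    (hF : Measurable F) (hG : Measurable G) (hX : Measurable X) {h : ℝ → ℝ≥0∞} (hh : Measurable h)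
    (hsupp : ∀ t > 0, h t = 0) {β : ℝ × ℝ → ℝ≥0∞} (hβ : Measurable β) :
    ∫⁻ z, F z.1 * (β z.2.2.2 * (h (cosAngle z.1 z.2.1 z.2.2.1) *
        (G z.2.1 * X (M.primed i j z.1 z.2.1 z.2.2)))) ∂collMeasure
      ≤ ENNReal.ofReal (M.minRatio i j ^ (-(3 * q⁻¹.toReal))) *
        (∫⁻ s, β s * ENNReal.ofReal (s.1 ^ (-q⁻¹.toReal) * (1 - s.2) ^ (-q⁻¹.toReal))
          ∂unitSquareMeasure) * (angMass h * (eLpNorm F 1 stateMeasure *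
            eLpNorm G p stateMeasure) * eLpNorm X q stateMeasure) := by
  have hi := M.mass_pos i
  have hj := M.mass_pos j
  have hμ := M.reducedMass_pos i j
  set t := q⁻¹.toReal with ht
  set K := angMass h * (eLpNorm G p stateMeasure * eLpNorm X q stateMeasure) with hK
  set J := ENNReal.ofReal (M.minRatio i j ^ (-(3 * t))) with hJ
  -- Seen from the second molecule, the relative velocity and the angular kernel are reflected.
  have hrefl : ∀ (x y : MolState) (σ : Dir), h (cosAngle x y σ)
      = (fun τ => h (-τ)) (inner ℝ (‖y.1 - x.1‖⁻¹ • (y.1 - x.1)) (σ : Vel)) := by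
    intro x y σ
    simp only [cosAngle]
    rw [← inner_neg_left, ← smul_neg, neg_sub, norm_sub_rev]
  have hmass : ENNReal.ofReal (2 * Real.pi) * ∫⁻ τ in Icc (-1 : ℝ) 1, h (-τ) = angMass h := by
    have := (Measure.measurePreserving_neg (volume : Measure ℝ)).setLIntegral_comp_preimage
      (measurableSet_Icc (a := (-1 : ℝ)) (b := 1)) hh
    rw [angMass, ← this]
    simp
  rw [lintegral_collMeasure_right (by fun_prop)]
  calc _ ≤ ∫⁻ x, F x * ((∫⁻ s, β s * ENNReal.ofReal (s.1 ^ (-t) * (1 - s.2) ^ (-t))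
          ∂unitSquareMeasure) * (J * K)) ∂stateMeasure := by
        refine lintegral_mono_ae ?_
        filter_upwards [ae_stateMeasure_snd_pos] with x hx
        rw [← lintegral_mul_const _ (by fun_prop), ← lintegral_const_mul _ (by fun_prop)]
        refine lintegral_mono_ae ?_
        filter_upwards [ae_unitSquareMeasure_mem] with s hs
        have h3 : 0 < 1 - s.2 := sub_pos.2 hs.2.2
        have h2 := hs.1.1
        have hkey := lintegral_mul_collision_le hpq
          (lam := M.mass j / (M.mass i + M.mass j)) (κ := s.1 * (1 - s.2))
          (c := M.mass j / (M.mass i + M.mass j) * √(2 * s.2 / M.reducedMass i j))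
          (m := M.reducedMass i j / 2) (I₀ := x.2) (by positivity) (by positivity) (by positivity)
          (by positivity) hx.le x.1 (h := fun τ => h (-τ)) (by fun_prop)
          (fun τ hτ => hsupp _ (neg_pos.2 hτ)) hG hX
        simp_rw [← M.primed_eq_right i j x _ _ hs.2.1.le] at hkey
        simp_rw [hmass] at hkey
        have hin : ∀ σ : Dir, ∫⁻ y, F x * (β s * (h (cosAngle x y σ) *
              (G y * X (M.primed i j x y (σ, s))))) ∂stateMeasure
            = F x * (β s * ∫⁻ y, h (cosAngle x y σ) *
              (G y * X (M.primed i j x y (σ, s))) ∂stateMeasure) := by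
          intro σ
          rw [lintegral_const_mul _ (by fun_prop), lintegral_const_mul _ (by fun_prop)]
        simp only [hin]
        rw [lintegral_const_mul _ (by fun_prop), lintegral_const_mul _ (by fun_prop), mul_assoc]
        gcongr
        simp only [hrefl]
        refine hkey.trans ?_
        calc _ ≤ (J * ENNReal.ofReal (s.1 ^ (-t) * (1 - s.2) ^ (-t))) * angMass h
                * eLpNorm G p stateMeasure * eLpNorm X q stateMeasure := by
              gcongr
              exact M.jacobian_rpow_le i j (M.minRatio_le_right i j) hs ENNReal.toReal_nonneg
          _ = _ := by rw [hK]; ring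
    _ = _ := by
        rw [lintegral_mul_const _ hF, eLpNorm_one_eq_lintegral_enorm (f := F)]
        simp only [enorm_eq_self]
        rw [hK]
        ring

end Mixture

/-! ### Center of mass coordinates -/

theorem lintegral_Ioi_sub_eq {a : ℝ} (f : ℝ → ℝ≥0∞) :
    ∫⁻ b in Ioi (0 : ℝ), f b = ∫⁻ s in Ioi a, f (s - a) := by
  rw [← lintegral_indicator measurableSet_Ioi, ← lintegral_indicator measurableSet_Ioi,
    ← lintegral_sub_right_eq_self _ a]
  refine lintegral_congr fun s => ?_
  simp [indicator]

theorem setLIntegral_Ioo_comp_mul {s : ℝ} (hs : 0 < s) {f : ℝ → ℝ≥0∞} (hf : Measurable f) :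
    ∫⁻ a in Ioo 0 s, f a = ENNReal.ofReal s * ∫⁻ t in Ioo (0 : ℝ) 1, f (t * s) := by
  rw [← lintegral_indicator measurableSet_Ioo, ← lintegral_indicator measurableSet_Ioo]
  have := lintegral_comp_smul_of_pos (volume : Measure ℝ) (hf.indicator measurableSet_Ioo) hs
    (f := (Ioo (0 : ℝ) s).indicator f)
  simp only [Module.finrank_self, pow_one, smul_eq_mul] at this
  have h1 : ∀ t, (Ioo (0 : ℝ) 1).indicator (fun t => f (t * s)) t
      = (Ioo (0 : ℝ) s).indicator f (s * t) := by
    intro t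
    have e1 : (0 < s * t ∧ s * t < s) ↔ (0 < t ∧ t < 1) := by
      rw [mul_pos_iff_of_pos_left hs, mul_lt_iff_lt_one_right hs]
    simp [indicator, e1, mul_comm t]
  simp only [h1]
  rw [this, ← mul_assoc, ← ENNReal.ofReal_mul hs.le, mul_inv_cancel₀ hs.ne']
  simp

/-- Splitting a pair of positive numbers into its sum and the fraction of the first summand. -/
theorem lintegral_Ioi_Ioi_eq {f : ℝ → ℝ → ℝ≥0∞} (hf : Measurable (Function.uncurry f)) :
    ∫⁻ a in Ioi (0 : ℝ), ∫⁻ b in Ioi (0 : ℝ), f a b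
      = ∫⁻ s in Ioi (0 : ℝ), ∫⁻ t in Ioo (0 : ℝ) 1, ENNReal.ofReal s * f (t * s) ((1 - t) * s) := by
  have hf' : ∀ {α : Type} [MeasurableSpace α] {u w : α → ℝ}, Measurable u → Measurable w →
      Measurable fun a => f (u a) (w a) := fun hu hw => hf.comp (hu.prodMk hw)
  have h1 : ∀ a : ℝ, ∫⁻ b in Ioi (0 : ℝ), f a b
      = ∫⁻ s, (Ioi a).indicator (fun s => f a (s - a)) s := by
    intro a
    rw [lintegral_Ioi_sub_eq (a := a), lintegral_indicator measurableSet_Ioi]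
  have hm : Measurable fun y : ℝ × ℝ => (Ioi y.1).indicator (fun s => f y.1 (s - y.1)) y.2 := by
    have : (fun y : ℝ × ℝ => (Ioi y.1).indicator (fun s => f y.1 (s - y.1)) y.2)
        = {y : ℝ × ℝ | y.1 < y.2}.indicator (fun y => f y.1 (y.2 - y.1)) := by
      ext y; simp [indicator]
    rw [this]
    exact (hf' measurable_fst (measurable_snd.sub measurable_fst)).indicator
      (measurableSet_lt measurable_fst measurable_snd)
  simp only [h1]
  rw [lintegral_lintegral_swap hm.aemeasurable, ← lintegral_indicator measurableSet_Ioi]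
  refine lintegral_congr fun s => ?_
  by_cases hs : 0 < s
  · rw [indicator_of_mem (show s ∈ Ioi (0 : ℝ) from hs), lintegral_const_mul _ (hf' (by fun_prop)
      (by fun_prop)), ← lintegral_indicator measurableSet_Ioi]
    have h2 := setLIntegral_Ioo_comp_mul hs (f := fun a => f a (s - a))
      (hf' (by fun_prop) (by fun_prop))
    have h3 : ∀ t : ℝ, s - t * s = (1 - t) * s := fun t => by ring
    simp only [h3] at h2
    rw [← h2, ← lintegral_indicator measurableSet_Ioo]
    refine lintegral_congr fun a => ?_
    by_cases ha : 0 < a <;> by_cases has : a < s <;> simp [indicator, ha, has]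
  · rw [indicator_of_notMem (show s ∉ Ioi (0 : ℝ) from hs), ← lintegral_indicator measurableSet_Ioi,
      lintegral_eq_zero_iff' (by
        refine Measurable.aemeasurable (Measurable.indicator ?_ measurableSet_Ioi)
        exact hm.comp (measurable_id.prodMk measurable_const))]
    refine ae_of_all _ fun a => ?_
    by_cases ha : 0 < a
    · have : ¬ a < s := fun h => hs (ha.trans h)
      simp [indicator, this]
    · simp [indicator, ha]

/-- Three positive energies `e, I, J` in terms of their sum `E`, the fraction `R` of `e` in it, and
the fraction `r` of `I` in `I + J`. -/
theorem lintegral_Ioi_Ioi_Ioi_eq {g : ℝ × ℝ × ℝ → ℝ≥0∞} (hg : Measurable g) :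
    ∫⁻ I in Ioi (0 : ℝ), ∫⁻ J in Ioi (0 : ℝ), ∫⁻ e in Ioi (0 : ℝ), g (e, I, J)
      = ∫⁻ E in Ioi (0 : ℝ), ∫⁻ R in Ioo (0 : ℝ) 1, ∫⁻ r in Ioo (0 : ℝ) 1,
        ENNReal.ofReal E * (ENNReal.ofReal ((1 - R) * E) *
          g (R * E, r * (1 - R) * E, (1 - r) * (1 - R) * E)) := by
  rw [lintegral_Ioi_Ioi_eq (by simp only [Function.uncurry_def]; fun_prop)]
  calc ∫⁻ s in Ioi (0 : ℝ), ∫⁻ t in Ioo (0 : ℝ) 1,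
        ENNReal.ofReal s * ∫⁻ e in Ioi (0 : ℝ), g (e, t * s, (1 - t) * s)
      = ∫⁻ s in Ioi (0 : ℝ), ∫⁻ e in Ioi (0 : ℝ), ∫⁻ t in Ioo (0 : ℝ) 1,
          ENNReal.ofReal s * g (e, t * s, (1 - t) * s) := by
        refine lintegral_congr fun s => ?_
        rw [lintegral_lintegral_swap (Measurable.aemeasurable (by fun_prop))]
        refine lintegral_congr fun t => ?_
        rw [lintegral_const_mul _ (by fun_prop)]
    _ = ∫⁻ e in Ioi (0 : ℝ), ∫⁻ s in Ioi (0 : ℝ), ∫⁻ t in Ioo (0 : ℝ) 1,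
          ENNReal.ofReal s * g (e, t * s, (1 - t) * s) :=
        lintegral_lintegral_swap (Measurable.aemeasurable (by fun_prop))
    _ = _ := by
        rw [lintegral_Ioi_Ioi_eq (by simp only [Function.uncurry_def]; fun_prop)]
        refine lintegral_congr fun E => lintegral_congr fun R => ?_
        rw [← lintegral_const_mul _ (by fun_prop)]
        simp only [mul_assoc]

/-- The kinetic energy `e = μρ²/2` replaces the relative speed `ρ`. -/
theorem lintegral_Ioi_sq_mul {μ : ℝ} (hμ : 0 < μ) (f : ℝ → ℝ≥0∞) :
    ∫⁻ ρ in Ioi (0 : ℝ), ENNReal.ofReal (ρ ^ 2) * f ρ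
      = ∫⁻ e in Ioi (0 : ℝ), ENNReal.ofReal (√(2 * e / μ) / μ) * f √(2 * e / μ) := by
  have hd : ∀ e ∈ Ioi (0 : ℝ), HasDerivWithinAt (fun e : ℝ => √(2 * e / μ))
      (2 / μ / (2 * √(2 * e / μ))) (Ioi 0) e := by
    intro e he
    have he : 0 < e := he
    have h1 : HasDerivAt (fun e : ℝ => 2 * e / μ) (2 / μ) e := by
      simpa using ((hasDerivAt_id e).const_mul 2).div_const μ
    exact (h1.sqrt (by positivity)).hasDerivWithinAt
  have hinj : InjOn (fun e : ℝ => √(2 * e / μ)) (Ioi 0) := by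
    intro a ha b hb hab
    have ha : 0 < a := ha
    have hb : 0 < b := hb
    have := (Real.sqrt_inj (by positivity) (by positivity)).1 hab
    field_simp at this
    exact this
  have himg : (fun e : ℝ => √(2 * e / μ)) '' Ioi 0 = Ioi 0 := by
    refine Subset.antisymm ?_ ?_
    · rintro _ ⟨e, he, rfl⟩
      have he : 0 < e := he
      exact Real.sqrt_pos.2 (by positivity)
    · intro ρ hρ
      have hρ : 0 < ρ := hρ
      refine ⟨μ * ρ ^ 2 / 2, mem_Ioi.2 (by positivity), ?_⟩
      have : 2 * (μ * ρ ^ 2 / 2) / μ = ρ ^ 2 := by field_simp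
      simp only [this]
      exact Real.sqrt_sq hρ.le
  conv_lhs => rw [← himg]
  rw [lintegral_image_eq_lintegral_abs_deriv_mul measurableSet_Ioi hd hinj]
  refine setLIntegral_congr_fun measurableSet_Ioi fun e he => ?_
  have he : 0 < e := he
  have hs : 0 < √(2 * e / μ) := Real.sqrt_pos.2 (by positivity)
  rw [← mul_assoc, abs_of_nonneg (by positivity), ← ENNReal.ofReal_mul (by positivity)]
  congr 2
  field_simp

/-- The measure `dV dE` on the velocities of the center of mass and the energies. -/
def centerMeasure : Measure (Vel × ℝ) :=
  (volume : Measure Vel).prod (volume.restrict (Ioi (0 : ℝ)))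

instance : SFinite centerMeasure := by unfold centerMeasure; infer_instance

namespace Mixture

variable {P : ℕ} (M : Mixture P) (i j : Fin P)

/-- The pair of molecules with center of mass velocity `V` and energy `E`, `n = (V, E)`, whose
relative velocity has direction `σ`, whose kinetic energy is the fraction `R` of the energy, and
whose internal energies are in the proportion `r : 1 - r`. -/
def collState (n : Vel × ℝ) (c : CollParam) : MolState × MolState :=
  ((n.1 + (M.mass j / (M.mass i + M.mass j)
      * √(2 * c.2.2 * n.2 / M.reducedMass i j)) • (c.1 : Vel), c.2.1 * (1 - c.2.2) * n.2),
    (n.1 - (M.mass i / (M.mass i + M.mass j)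
      * √(2 * c.2.2 * n.2 / M.reducedMass i j)) • (c.1 : Vel), (1 - c.2.1) * (1 - c.2.2) * n.2))

/-- The Jacobian of `collState`. -/
def collJac (E : ℝ) (c : CollParam) : ℝ :=
  E * ((1 - c.2.2) * E) * (√(2 * c.2.2 * E / M.reducedMass i j) / M.reducedMass i j)

@[fun_prop]
theorem measurable_collState {α : Type*} [MeasurableSpace α] {n : α → Vel × ℝ} {c : α → CollParam}
    (hn : Measurable n) (hc : Measurable c) : Measurable fun a => M.collState i j (n a) (c a) := by
  unfold collState
  fun_prop

@[fun_prop]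
theorem measurable_collJac {α : Type*} [MeasurableSpace α] {E : α → ℝ} {c : α → CollParam}
    (hn : Measurable E) (hc : Measurable c) : Measurable fun a => M.collJac i j (E a) (c a) := by
  unfold collJac
  fun_prop

/-- The velocity of the center of mass and the relative velocity replace a pair of velocities, with
Jacobian `1`. -/
theorem lintegral_lintegral_vel {F : Vel → Vel → ℝ≥0∞} (hF : Measurable (Function.uncurry F)) :
    ∫⁻ v, ∫⁻ w, F v w = ∫⁻ V, ∫⁻ u, F (V + (M.mass j / (M.mass i + M.mass j)) • u)
      (V - (M.mass i / (M.mass i + M.mass j)) • u) := by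
  have hF' : ∀ {α : Type} [MeasurableSpace α] {u w : α → Vel}, Measurable u → Measurable w →
      Measurable fun a => F (u a) (w a) := fun hu hw => hF.comp (hu.prodMk hw)
  have hi := M.mass_pos i
  have hj := M.mass_pos j
  have hsum : (M.mass j / (M.mass i + M.mass j)) + (M.mass i / (M.mass i + M.mass j)) = 1 := by
    field_simp; ring
  calc ∫⁻ v, ∫⁻ w, F v w = ∫⁻ v, ∫⁻ u, F v (v - u) := by
        refine lintegral_congr fun v => ?_
        exact (lintegral_sub_left_eq_self (fun w => F v w) v).symm
    _ = ∫⁻ u, ∫⁻ v, F v (v - u) := lintegral_lintegral_swap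
        (hF' measurable_fst (measurable_fst.sub measurable_snd)).aemeasurable
    _ = ∫⁻ u, ∫⁻ V, F (V + (M.mass j / (M.mass i + M.mass j)) • u)
          (V - (M.mass i / (M.mass i + M.mass j)) • u) := by
        refine lintegral_congr fun u => ?_
        rw [← lintegral_add_right_eq_self (fun v => F v (v - u))
          ((M.mass j / (M.mass i + M.mass j)) • u)]
        refine lintegral_congr fun V => ?_
        congr 1
        have : u = (M.mass j / (M.mass i + M.mass j)) • u + (M.mass i / (M.mass i + M.mass j)) • u := by
          rw [← add_smul, hsum, one_smul]
        conv_lhs => rw [add_sub_assoc]; rhs; rhs; rw [this]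
        abel
    _ = _ := lintegral_lintegral_swap (hF' (by fun_prop) (by fun_prop)).aemeasurable

set_option maxHeartbeats 1000000 in
/-- Center of mass coordinates for a pair of molecules. -/
theorem lintegral_pair_eq {F : MolState × MolState → ℝ≥0∞} (hF : Measurable F) :
    ∫⁻ x, ∫⁻ y, F (x, y) ∂stateMeasure ∂stateMeasure
      = ∫⁻ n, ∫⁻ c, ENNReal.ofReal (M.collJac i j n.2 c) * F (M.collState i j n c)
          ∂paramMeasure ∂centerMeasure := by
  have hμ := M.reducedMass_pos i j
  set μ := M.reducedMass i j with hμd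
  let g : (Vel × Dir) → ℝ × ℝ × ℝ → ℝ≥0∞ := fun a t => ENNReal.ofReal (√(2 * t.1 / μ) / μ) *
    F ((a.1 + (M.mass j / (M.mass i + M.mass j) * √(2 * t.1 / μ)) • (a.2 : Vel), t.2.1),
      (a.1 - (M.mass i / (M.mass i + M.mass j) * √(2 * t.1 / μ)) • (a.2 : Vel), t.2.2))
  have hg : Measurable (Function.uncurry g) := by simp only [Function.uncurry_def, g]; fun_prop
  have hg' : ∀ {α : Type} [MeasurableSpace α] {u : α → Vel × Dir} {w : α → ℝ × ℝ × ℝ},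
      Measurable u → Measurable w →
      Measurable fun a => g (u a) (w a) := fun hu hw => hg.comp (hu.prodMk hw)
  let τ : Measure (Vel × Dir) := (volume : Measure Vel).prod (volume : Measure Vel).toSphere
  have : SFinite ((volume : Measure Vel).toSphere : Measure Dir) := inferInstance
  have : SFinite τ := Measure.prod.instSFinite
  -- The velocities, at fixed internal energies.
  have hvel : ∀ I J : ℝ, ∫⁻ v : Vel, ∫⁻ w : Vel, F ((v, I), (w, J))
      = ∫⁻ a, (∫⁻ e in Ioi (0 : ℝ), g a (e, I, J)) ∂τ := by
    intro I J
    have hm : Measurable fun a => ∫⁻ e in Ioi (0 : ℝ), g a (e, I, J) :=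
      (hg' (u := fun y : (Vel × Dir) × ℝ => y.1) (w := fun y => (y.2, I, J)) (by fun_prop)
        (by fun_prop)).lintegral_prod_right'
    rw [M.lintegral_lintegral_vel i j (F := fun v w => F ((v, I), (w, J)))
      (by simp only [Function.uncurry_def]; fun_prop), lintegral_prod _ hm.aemeasurable]
    refine lintegral_congr fun V => ?_
    rw [lintegral_eq_lintegral_toSphere _ (by fun_prop)]
    refine lintegral_congr fun σ => ?_
    have hdim : Module.finrank ℝ Vel - 1 = 2 := by simp
    rw [hdim, lintegral_Ioi_sq_mul hμ]
    simp only [smul_smul, g]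
  calc ∫⁻ x, ∫⁻ y, F (x, y) ∂stateMeasure ∂stateMeasure
      = ∫⁻ v : Vel, ∫⁻ I in Ioi (0 : ℝ), ∫⁻ w : Vel, ∫⁻ J in Ioi (0 : ℝ), F ((v, I), (w, J)) := by
        rw [lintegral_stateMeasure (by fun_prop), ← restrict_Ioi_eq_restrict_Ici]
        refine lintegral_congr fun v => lintegral_congr fun I => ?_
        rw [lintegral_stateMeasure (by fun_prop), ← restrict_Ioi_eq_restrict_Ici]
    _ = ∫⁻ I in Ioi (0 : ℝ), ∫⁻ J in Ioi (0 : ℝ), ∫⁻ v : Vel, ∫⁻ w : Vel, F ((v, I), (w, J)) := by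
        rw [lintegral_lintegral_swap (Measurable.aemeasurable (by fun_prop))]
        refine lintegral_congr fun I => ?_
        rw [lintegral_lintegral_swap (Measurable.aemeasurable (by fun_prop))]
        calc _ = ∫⁻ w : Vel, ∫⁻ J in Ioi (0 : ℝ), ∫⁻ v : Vel, F ((v, I), (w, J)) :=
              lintegral_congr fun w =>
                lintegral_lintegral_swap (Measurable.aemeasurable (by fun_prop))
          _ = ∫⁻ J in Ioi (0 : ℝ), ∫⁻ w : Vel, ∫⁻ v : Vel, F ((v, I), (w, J)) :=
              lintegral_lintegral_swap (Measurable.aemeasurable (by fun_prop))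
          _ = _ := lintegral_congr fun J =>
                lintegral_lintegral_swap (Measurable.aemeasurable (by fun_prop))
    _ = ∫⁻ I in Ioi (0 : ℝ), ∫⁻ J in Ioi (0 : ℝ), ∫⁻ a, (∫⁻ e in Ioi (0 : ℝ), g a (e, I, J)) ∂τ := by
        simp only [hvel]
    _ = ∫⁻ a, (∫⁻ I in Ioi (0 : ℝ), ∫⁻ J in Ioi (0 : ℝ), ∫⁻ e in Ioi (0 : ℝ), g a (e, I, J)) ∂τ := by
        have hm3 : Measurable fun y : ((ℝ × ℝ) × (Vel × Dir)) × ℝ => g y.1.2 (y.2, y.1.1) :=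
          hg' (by fun_prop) (by fun_prop)
        have hm2 : Measurable fun y : (ℝ × ℝ) × (Vel × Dir) =>
            ∫⁻ e in Ioi (0 : ℝ), g y.2 (e, y.1) := hm3.lintegral_prod_right'
        have hm1 : Measurable fun y : (ℝ × (Vel × Dir)) × ℝ =>
            ∫⁻ e in Ioi (0 : ℝ), g y.1.2 (e, y.1.1, y.2) :=
          hm2.comp (f := fun y : (ℝ × (Vel × Dir)) × ℝ => ((y.1.1, y.2), y.1.2)) (by fun_prop)
        calc _ = ∫⁻ I in Ioi (0 : ℝ), ∫⁻ a, (∫⁻ J in Ioi (0 : ℝ), ∫⁻ e in Ioi (0 : ℝ),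
                g a (e, I, J)) ∂τ := by
              refine lintegral_congr fun I => lintegral_lintegral_swap ?_
              exact (hm2.comp (f := fun y : ℝ × (Vel × Dir) => ((I, y.1), y.2))
                (by fun_prop)).aemeasurable
          _ = _ := lintegral_lintegral_swap hm1.lintegral_prod_right'.aemeasurable
    _ = ∫⁻ a, (∫⁻ E in Ioi (0 : ℝ), ∫⁻ R in Ioo (0 : ℝ) 1, ∫⁻ r in Ioo (0 : ℝ) 1,
        ENNReal.ofReal E * (ENNReal.ofReal ((1 - R) * E) *
          g a (R * E, r * (1 - R) * E, (1 - r) * (1 - R) * E))) ∂τ :=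
        lintegral_congr fun a => lintegral_Ioi_Ioi_Ioi_eq (hg' measurable_const measurable_id)
    _ = ∫⁻ a, (∫⁻ E in Ioi (0 : ℝ), ∫⁻ R in Ioo (0 : ℝ) 1, ∫⁻ r in Ioo (0 : ℝ) 1,
        ENNReal.ofReal (M.collJac i j E (a.2, r, R)) *
          F (M.collState i j (a.1, E) (a.2, r, R))) ∂τ := by
        refine lintegral_congr fun a => setLIntegral_congr_fun measurableSet_Ioi fun E hE =>
          setLIntegral_congr_fun measurableSet_Ioo fun R hR => lintegral_congr fun r => ?_
        have hE : 0 < E := hE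
        have hR : 0 < 1 - R := sub_pos.2 hR.2
        simp only [g, collJac, collState]
        rw [← mul_assoc, ← mul_assoc, ← ENNReal.ofReal_mul hE.le,
          ← ENNReal.ofReal_mul (by positivity), ← hμd, mul_assoc 2 R E]
    _ = ∫⁻ V : Vel, ∫⁻ σ : Dir, (∫⁻ E in Ioi (0 : ℝ), ∫⁻ r in Ioo (0 : ℝ) 1, ∫⁻ R in Ioo (0 : ℝ) 1,
        ENNReal.ofReal (M.collJac i j E (σ, r, R)) *
          F (M.collState i j (V, E) (σ, r, R))) ∂(volume : Measure Vel).toSphere := by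
        rw [lintegral_prod _ (Measurable.aemeasurable (by fun_prop))]
        refine lintegral_congr fun V => lintegral_congr fun σ => lintegral_congr fun E => ?_
        exact lintegral_lintegral_swap (Measurable.aemeasurable (by fun_prop))
    _ = _ := by
        rw [centerMeasure, lintegral_prod _ (Measurable.aemeasurable (by fun_prop))]
        refine lintegral_congr fun V => ?_
        rw [lintegral_lintegral_swap (Measurable.aemeasurable (by fun_prop))]
        refine lintegral_congr fun E => ?_
        rw [paramMeasure, lintegral_prod _ (Measurable.aemeasurable (by fun_prop))]
        refine lintegral_congr fun σ => ?_
        rw [unitSquareMeasure, lintegral_prod _ (Measurable.aemeasurable (by fun_prop)),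
          restrict_Ioo_eq_restrict_Icc]

end Mixture

/-! ### Interchange of pre- and postcollisional molecules -/

theorem ae_paramMeasure_mem :
    ∀ᵐ c ∂paramMeasure, c.2.1 ∈ Ioo (0 : ℝ) 1 ∧ c.2.2 ∈ Ioo (0 : ℝ) 1 :=
  Measure.quasiMeasurePreserving_snd.ae ae_unitSquareMeasure_mem

theorem ae_centerMeasure_snd_pos : ∀ᵐ n ∂centerMeasure, 0 < n.2 :=
  Measure.quasiMeasurePreserving_snd.ae (ae_restrict_mem measurableSet_Ioi)

/-- The measure `dV dE dσ' dr' dR' dσ dr dR`. -/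
def centerCollMeasure : Measure ((Vel × ℝ) × CollParam × CollParam) :=
  centerMeasure.prod (paramMeasure.prod paramMeasure)

/-- The range of the parameters on which the center of mass coordinates are nonsingular. -/
def IsRegularColl (y : (Vel × ℝ) × CollParam × CollParam) : Prop :=
  0 < y.1.2 ∧ (y.2.1.2.1 ∈ Ioo (0 : ℝ) 1 ∧ y.2.1.2.2 ∈ Ioo (0 : ℝ) 1) ∧
    (y.2.2.2.1 ∈ Ioo (0 : ℝ) 1 ∧ y.2.2.2.2 ∈ Ioo (0 : ℝ) 1)

theorem ae_isRegularColl : ∀ᵐ y ∂centerCollMeasure, IsRegularColl y := by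
  have h1 := Measure.quasiMeasurePreserving_fst (μ := centerMeasure)
    (ν := paramMeasure.prod paramMeasure) |>.ae ae_centerMeasure_snd_pos
  have h0 := Measure.quasiMeasurePreserving_snd (μ := centerMeasure)
    (ν := paramMeasure.prod paramMeasure)
  have h2 := h0.ae ((Measure.quasiMeasurePreserving_fst (μ := paramMeasure)
    (ν := paramMeasure)).ae ae_paramMeasure_mem)
  have h3 := h0.ae ((Measure.quasiMeasurePreserving_snd (μ := paramMeasure)
    (ν := paramMeasure)).ae ae_paramMeasure_mem)
  filter_upwards [h1, h2, h3] with y a b c using ⟨a, b, c⟩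

theorem measurePreserving_swap_center :
    MeasurePreserving (fun y : (Vel × ℝ) × CollParam × CollParam => (y.1, y.2.2, y.2.1))
      centerCollMeasure centerCollMeasure :=
  (MeasurePreserving.id centerMeasure).prod Measure.measurePreserving_swap

namespace Mixture

variable {P : ℕ} (M : Mixture P) (i j : Fin P)

theorem relVel_collState (n : Vel × ℝ) (c : CollParam) :
    (M.collState i j n c).1.1 - (M.collState i j n c).2.1
      = √(2 * c.2.2 * n.2 / M.reducedMass i j) • (c.1 : Vel) := by
  have hi := M.mass_pos i
  have hj := M.mass_pos j
  have hsum : (M.mass j / (M.mass i + M.mass j)) + (M.mass i / (M.mass i + M.mass j)) = 1 := by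
    field_simp; ring
  have : ∀ a b d : Vel, a + b - (a - d) = b + d := fun a b d => by abel
  rw [collState]
  simp only
  rw [this, ← add_smul, ← add_mul, hsum, one_mul]

theorem centerVel_collState (n : Vel × ℝ) (c : CollParam) :
    M.centerVel i j (M.collState i j n c).1.1 (M.collState i j n c).2.1 = n.1 := by
  have h := M.centerVel_add i j (M.collState i j n c).1.1 (M.collState i j n c).2.1
  rw [relVel_collState, smul_smul] at h
  exact add_right_cancel (b := (M.mass j / (M.mass i + M.mass j)
      * √(2 * c.2.2 * n.2 / M.reducedMass i j)) • (c.1 : Vel)) h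

theorem reducedMass_mul_relVel_sq {n : Vel × ℝ} {c : CollParam} (hn : 0 ≤ n.2) (hc : 0 ≤ c.2.2) :
    M.reducedMass i j * ‖(M.collState i j n c).1.1 - (M.collState i j n c).2.1‖ ^ 2
      = 2 * (c.2.2 * n.2) := by
  have hμ := M.reducedMass_pos i j
  rw [relVel_collState, norm_smul, mul_pow, Real.norm_eq_abs, sq_abs,
    Real.sq_sqrt (by positivity)]
  simp only [norm_eq_of_mem_sphere]
  field_simp

theorem energy_collState {n : Vel × ℝ} {c : CollParam} (hn : 0 ≤ n.2) (hc : 0 ≤ c.2.2) :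
    M.energy i j (M.collState i j n c).1 (M.collState i j n c).2 = n.2 := by
  have h := M.reducedMass_mul_relVel_sq i j hn hc
  rw [energy]
  have h1 : (M.collState i j n c).1.2 = c.2.1 * (1 - c.2.2) * n.2 := rfl
  have h2 : (M.collState i j n c).2.2 = (1 - c.2.1) * (1 - c.2.2) * n.2 := rfl
  rw [h1, h2]
  linarith

/-- In center of mass coordinates, a collision replaces the parameters `c'` of the incoming pair
by the collision parameters `c`. -/
theorem primed_collState {n : Vel × ℝ} {c' : CollParam} (hn : 0 ≤ n.2) (hc : 0 ≤ c'.2.2)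
    (c : CollParam) : M.primed i j (M.collState i j n c').1 (M.collState i j n c').2 c
      = (M.collState i j n c).1 := by
  rw [primed, centerVel_collState, M.energy_collState i j hn hc]
  rfl

theorem primedStar_collState {n : Vel × ℝ} {c' : CollParam} (hn : 0 ≤ n.2) (hc : 0 ≤ c'.2.2)
    (c : CollParam) : M.primedStar i j (M.collState i j n c').1 (M.collState i j n c').2 c
      = (M.collState i j n c).2 := by
  rw [primedStar, centerVel_collState, M.energy_collState i j hn hc]
  rfl

theorem unit_relVel_collState {n : Vel × ℝ} {c : CollParam} (hn : 0 < n.2) (hc : 0 < c.2.2) :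
    ‖(M.collState i j n c).1.1 - (M.collState i j n c).2.1‖⁻¹ •
      ((M.collState i j n c).1.1 - (M.collState i j n c).2.1) = (c.1 : Vel) := by
  have hμ := M.reducedMass_pos i j
  have hs : 0 < √(2 * c.2.2 * n.2 / M.reducedMass i j) := Real.sqrt_pos.2 (by positivity)
  rw [relVel_collState, norm_smul, smul_smul, Real.norm_of_nonneg hs.le]
  simp [hs.ne']

theorem primedr_collState {n : Vel × ℝ} {c : CollParam} (hn : 0 < n.2) (hc : c.2.2 < 1) :
    primedr (M.collState i j n c).1 (M.collState i j n c).2 = c.2.1 := by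
  have h1 : (M.collState i j n c).1.2 = c.2.1 * (1 - c.2.2) * n.2 := rfl
  have h2 : (M.collState i j n c).2.2 = (1 - c.2.1) * (1 - c.2.2) * n.2 := rfl
  have h3 : (1 - c.2.2) * n.2 ≠ 0 := (mul_pos (sub_pos.2 hc) hn).ne'
  rw [primedr, h1, h2, div_eq_iff (by
    rw [← add_mul, ← add_mul, add_sub_cancel, one_mul]; exact h3)]
  ring

theorem primedR_collState {n : Vel × ℝ} {c : CollParam} (hn : 0 < n.2) (hc : 0 ≤ c.2.2) :
    M.primedR i j (M.collState i j n c).1 (M.collState i j n c).2 = c.2.2 := by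
  rw [primedR, M.reducedMass_mul_relVel_sq i j hn.le hc, M.energy_collState i j hn.le hc]
  field_simp

theorem collJac_pos {E : ℝ} {c : CollParam} (hE : 0 < E) (hc : c.2.2 ∈ Ioo (0 : ℝ) 1) :
    0 < M.collJac i j E c := by
  have hμ := M.reducedMass_pos i j
  have h1 : 0 < 1 - c.2.2 := sub_pos.2 hc.2
  have h2 := hc.1
  unfold collJac
  have : 0 < √(2 * c.2.2 * E / M.reducedMass i j) := Real.sqrt_pos.2 (by positivity)
  positivity

theorem dens_nonneg {r R : ℝ} (hr : r ∈ Icc (0 : ℝ) 1) (hR : R ∈ Icc (0 : ℝ) 1) :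
    0 ≤ M.dens i j r R := by
  have h1 := hr.1
  have h2 : 0 ≤ 1 - r := sub_nonneg.2 hr.2
  have h3 : 0 ≤ 1 - R := sub_nonneg.2 hR.2
  unfold dens
  positivity

/-- The interchange of the pre- and postcollisional molecules takes the measure
`d_ij(r, R) dv dI dv_* dI_* dσ dr dR` to the one with the weights
`(I / I')^α_i (I_* / I'_*)^α_j` of the gain operator as an additional factor. -/
theorem weight_mul_collJac {n : Vel × ℝ} {c c' : CollParam} (hy : IsRegularColl (n, c', c)) :
    ((M.collState i j n c').1.2 / (M.collState i j n c).1.2) ^ M.alpha i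
      * ((M.collState i j n c').2.2 / (M.collState i j n c).2.2) ^ M.alpha j
      * M.dens i j c.2.1 c.2.2 * M.collJac i j n.2 c'
    = M.dens i j c'.2.1 c'.2.2 * M.collJac i j n.2 c := by
  obtain ⟨hE, ⟨hr', hR'⟩, ⟨hr, hR⟩⟩ := hy
  simp only at hE hr' hR' hr hR
  have hμ := M.reducedMass_pos i j
  have e : ∀ c : CollParam, √(2 * c.2.2 * n.2 / M.reducedMass i j)
      = √c.2.2 * √(2 * n.2 / M.reducedMass i j) := by
    intro c
    rw [← Real.sqrt_mul' _ (by positivity)]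
    congr 1
    ring
  simp only [collState, collJac, dens, e]
  generalize √(2 * n.2 / M.reducedMass i j) = S
  generalize hE' : n.2 = E at hE
  generalize c'.2.1 = r' at *
  generalize c'.2.2 = R' at *
  generalize c.2.1 = r at *
  generalize c.2.2 = R at *
  have p1 := hr.1
  have p2 : 0 < 1 - r := sub_pos.2 hr.2
  have p3 := hr'.1
  have p4 : 0 < 1 - r' := sub_pos.2 hr'.2
  have p5 : 0 < 1 - R := sub_pos.2 hR.2
  have p6 : 0 < 1 - R' := sub_pos.2 hR'.2
  have q1 : r' * (1 - R') * E / (r * (1 - R) * E) = (r' * (1 - R')) / (r * (1 - R)) := by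
    field_simp
  have q2 : (1 - r') * (1 - R') * E / ((1 - r) * (1 - R) * E)
      = ((1 - r') * (1 - R')) / ((1 - r) * (1 - R)) := by
    field_simp
  rw [q1, q2, Real.div_rpow (by positivity) (by positivity),
    Real.div_rpow (by positivity) (by positivity), Real.mul_rpow p3.le p6.le,
    Real.mul_rpow p1.le p5.le, Real.mul_rpow p4.le p6.le, Real.mul_rpow p2.le p5.le,
    Real.rpow_add p5, Real.rpow_add p5, Real.rpow_add p6, Real.rpow_add p6, Real.rpow_one,
    Real.rpow_one]
  have n1 := (Real.rpow_pos_of_pos p1 (M.alpha i)).ne'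
  have n2 := (Real.rpow_pos_of_pos p2 (M.alpha j)).ne'
  have n3 := (Real.rpow_pos_of_pos p5 (M.alpha i)).ne'
  have n4 := (Real.rpow_pos_of_pos p5 (M.alpha j)).ne'
  field_simp

/-- The collision variables with center of mass coordinates `n`, parameters `c'` of the incoming
pair and collision parameters `c`, `y = (n, c', c)`. -/
def collVar (y : (Vel × ℝ) × CollParam × CollParam) : MolState × MolState × CollParam :=
  ((M.collState i j y.1 y.2.1).1, (M.collState i j y.1 y.2.1).2, y.2.2)

@[fun_prop]
theorem measurable_collVar : Measurable (M.collVar i j) := by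
  unfold collVar
  fun_prop

/-- The density of `dv dI dv_* dI_* dσ dr dR` in the variables of `collVar`. -/
def collDensity (y : (Vel × ℝ) × CollParam × CollParam) : ℝ≥0∞ :=
  ENNReal.ofReal (M.collJac i j y.1.2 y.2.1)

@[fun_prop]
theorem measurable_collDensity : Measurable (M.collDensity i j) := by
  unfold collDensity
  fun_prop

theorem lintegral_collMeasure_eq {Φ : MolState × MolState × CollParam → ℝ≥0∞}
    (hΦ : Measurable Φ) : ∫⁻ z, Φ z ∂collMeasure
      = ∫⁻ y, M.collDensity i j y * Φ (M.collVar i j y) ∂centerCollMeasure := by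
  rw [collMeasure, lintegral_prod _ hΦ.aemeasurable]
  calc _ = ∫⁻ x, ∫⁻ y, ∫⁻ c, Φ (x, y, c) ∂paramMeasure ∂stateMeasure ∂stateMeasure := by
        refine lintegral_congr fun x => ?_
        rw [lintegral_prod _ (Measurable.aemeasurable (by fun_prop))]
    _ = _ := by
        rw [M.lintegral_pair_eq i j (F := fun w => ∫⁻ c, Φ (w.1, w.2, c) ∂paramMeasure)
          (by fun_prop), centerCollMeasure,
          lintegral_prod _ (Measurable.aemeasurable (by fun_prop))]
        refine lintegral_congr fun n => ?_
        rw [lintegral_prod _ (Measurable.aemeasurable (by fun_prop))]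
        refine lintegral_congr fun c' => ?_
        rw [← lintegral_const_mul _ (by fun_prop)]
        rfl

theorem collMeasure_eq_map :
    collMeasure = (centerCollMeasure.withDensity (M.collDensity i j)).map (M.collVar i j) := by
  refine Measure.ext fun s hs => ?_
  have hm : Measurable (s.indicator (1 : MolState × MolState × CollParam → ℝ≥0∞)) :=
    measurable_one.indicator hs
  rw [← lintegral_indicator_one hs, M.lintegral_collMeasure_eq i j hm, ← lintegral_indicator_one hs,
    lintegral_map hm (by fun_prop),
    lintegral_withDensity_eq_lintegral_mul (g := fun y => s.indicator 1 (M.collVar i j y)) _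
      (by fun_prop) (hm.comp (by fun_prop))]
  rfl

theorem lintegral_collMeasure_le (Φ : MolState × MolState × CollParam → ℝ≥0∞) :
    ∫⁻ z, Φ z ∂collMeasure
      ≤ ∫⁻ y, M.collDensity i j y * Φ (M.collVar i j y) ∂centerCollMeasure := by
  rw [M.collMeasure_eq_map i j]
  exact (lintegral_map_le _ _).trans (lintegral_withDensity_le_lintegral_mul _ (by fun_prop) _)

theorem ae_collVar {p : MolState × MolState × CollParam → Prop} (hp : ∀ᵐ z ∂collMeasure, p z) :
    ∀ᵐ y ∂centerCollMeasure, p (M.collVar i j y) := by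
  rw [M.collMeasure_eq_map i j] at hp
  have h1 := ae_of_ae_map (by fun_prop) hp
  rw [ae_withDensity_iff (by fun_prop)] at h1
  filter_upwards [h1, ae_isRegularColl] with y hy hreg
  refine hy ?_
  exact (ENNReal.ofReal_pos.2 (M.collJac_pos i j hreg.1 hreg.2.1.2)).ne'

/-- The change of variables from pre- to postcollisional molecules, as an inequality. No
measurability of `Φ` is needed, since the collision variables are the image of the center of mass
coordinates. -/
theorem lintegral_collMeasure_le_of_swap {Φ Ψ : MolState × MolState × CollParam → ℝ≥0∞}
    (hΨ : Measurable Ψ) (h : ∀ᵐ y ∂centerCollMeasure,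
      M.collDensity i j y * Φ (M.collVar i j y) ≤
        M.collDensity i j (y.1, y.2.2, y.2.1) * Ψ (M.collVar i j (y.1, y.2.2, y.2.1))) :
    ∫⁻ z, Φ z ∂collMeasure ≤ ∫⁻ z, Ψ z ∂collMeasure := by
  refine (M.lintegral_collMeasure_le i j Φ).trans ((lintegral_mono_ae h).trans (le_of_eq ?_))
  rw [M.lintegral_collMeasure_eq i j hΨ]
  exact measurePreserving_swap_center.lintegral_comp
    (f := fun y => M.collDensity i j y * Ψ (M.collVar i j y)) (by fun_prop)

/-- The map from the collision variables to the postcollisional molecules preserves null sets. -/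
theorem quasiMeasurePreserving_primed : Measure.QuasiMeasurePreserving
    (fun z : MolState × MolState × CollParam =>
      (M.primed i j z.1 z.2.1 z.2.2, M.primedStar i j z.1 z.2.1 z.2.2))
    collMeasure (stateMeasure.prod stateMeasure) := by
  refine ⟨by fun_prop, Measure.AbsolutelyContinuous.mk fun s hs h0 => ?_⟩
  have hp : ∀ᵐ z ∂collMeasure, (z.1, z.2.1) ∉ s := by
    have h1 : ∀ᵐ w ∂((stateMeasure.prod stateMeasure).prod paramMeasure), w.1 ∉ s :=
      Measure.quasiMeasurePreserving_fst.ae (measure_eq_zero_iff_ae_notMem.1 h0)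
    have h2 : MeasurePreserving (MeasurableEquiv.prodAssoc.symm :
        MolState × MolState × CollParam ≃ᵐ (MolState × MolState) × CollParam) collMeasure
        ((stateMeasure.prod stateMeasure).prod paramMeasure) :=
      (measurePreserving_prodAssoc stateMeasure stateMeasure paramMeasure).symm _
    exact h2.quasiMeasurePreserving.ae h1
  have h3 := measurePreserving_swap_center.quasiMeasurePreserving.ae (M.ae_collVar i j hp)
  have hm : Measurable fun z : MolState × MolState × CollParam =>
      (M.primed i j z.1 z.2.1 z.2.2, M.primedStar i j z.1 z.2.1 z.2.2) := by fun_prop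
  rw [Measure.map_apply hm hs, ← lintegral_indicator_one (hm hs),
    M.lintegral_collMeasure_eq i j (measurable_one.indicator (hm hs))]
  refine (lintegral_congr_ae (g := fun _ => 0) ?_).trans lintegral_zero
  filter_upwards [h3, ae_isRegularColl] with y hy hreg
  have h4 := M.primed_collState i j hreg.1.le hreg.2.1.2.1.le y.2.2
  have h5 := M.primedStar_collState i j hreg.1.le hreg.2.1.2.1.le y.2.2
  have h6 : M.collVar i j y ∉ (fun z : MolState × MolState × CollParam =>
      (M.primed i j z.1 z.2.1 z.2.2, M.primedStar i j z.1 z.2.1 z.2.2)) ⁻¹' s := by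
    simp only [collVar, mem_preimage]
    rw [h4, h5]
    exact hy
  simp [h6]

end Mixture

/-! ### The weighted estimate of the weak form -/

namespace Mixture

variable {P : ℕ} (M : Mixture P) (i j : Fin P)

/-- The product of a function with values in `[0, ∞]` and a power of the Lebesgue bracket. -/
def weighted (k : ℝ) (F : MolState → ℝ≥0∞) (x : MolState) : ℝ≥0∞ :=
  F x * ENNReal.ofReal (M.bracket i x ^ k)

@[fun_prop]
theorem measurable_weighted (k : ℝ) {F : MolState → ℝ≥0∞} (hF : Measurable F) :
    Measurable (M.weighted i k F) := by
  unfold weighted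
  fun_prop

/-- The integrand of the weak form after the change of variables, with the collision kernel
replaced by its upper bound. The function `β` stands for the product of the energy exchange part of
the kernel and the density `d_ij`. -/
def weakIntegrand (γ k : ℝ) (F G X : MolState → ℝ≥0∞) (h : ℝ → ℝ≥0∞) (β : ℝ × ℝ → ℝ≥0∞)
    (z : MolState × MolState × CollParam) : ℝ≥0∞ :=
  F z.1 * G z.2.1 * X (M.primed i j z.1 z.2.1 z.2.2)
    * ENNReal.ofReal (M.bracket i (M.primed i j z.1 z.2.1 z.2.2) ^ k
      * (M.energy i j z.1 z.2.1 / M.totalMass) ^ (γ / 2))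
    * h (cosAngle z.1 z.2.1 z.2.2.1) * β z.2.2.2

theorem measurable_weakIntegrand (γ k : ℝ) {F G X : MolState → ℝ≥0∞} (hF : Measurable F)
    (hG : Measurable G) (hX : Measurable X) {h : ℝ → ℝ≥0∞} (hh : Measurable h)
    {β : ℝ × ℝ → ℝ≥0∞} (hβ : Measurable β) : Measurable (M.weakIntegrand i j γ k F G X h β) := by
  unfold weakIntegrand
  fun_prop

theorem ae_collMeasure_mem : ∀ᵐ z ∂collMeasure, 0 ≤ z.1.2 ∧ 0 ≤ z.2.1.2 ∧
    z.2.2.2.1 ∈ Ioo (0 : ℝ) 1 ∧ z.2.2.2.2 ∈ Ioo (0 : ℝ) 1 := by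
  have h0 := Measure.quasiMeasurePreserving_snd (μ := stateMeasure)
    (ν := stateMeasure.prod paramMeasure)
  have h1 := (Measure.quasiMeasurePreserving_fst (μ := stateMeasure)
    (ν := stateMeasure.prod paramMeasure)).ae ae_stateMeasure_snd_pos
  have h2 := h0.ae ((Measure.quasiMeasurePreserving_fst (μ := stateMeasure)
    (ν := paramMeasure)).ae ae_stateMeasure_snd_pos)
  have h3 := h0.ae ((Measure.quasiMeasurePreserving_snd (μ := stateMeasure)
    (ν := paramMeasure)).ae ae_paramMeasure_mem)
  filter_upwards [h1, h2, h3] with z a b c using ⟨a.le, b.le, c⟩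

theorem inner_nonneg_of_cosAngle {x y : MolState} {σ : Dir} (h : 0 ≤ cosAngle x y σ) :
    0 ≤ inner ℝ (x.1 - y.1) (σ : Vel) := by
  rw [cosAngle, real_inner_smul_left] at h
  rcases eq_or_ne (x.1 - y.1) 0 with h0 | h0
  · simp [h0]
  · exact (mul_nonneg_iff_of_pos_left (inv_pos.2 (norm_pos_iff.2 h0))).1 h

theorem inner_nonpos_of_cosAngle {x y : MolState} {σ : Dir} (h : cosAngle x y σ ≤ 0) :
    inner ℝ (x.1 - y.1) (σ : Vel) ≤ 0 := by
  rw [cosAngle, real_inner_smul_left] at h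
  rcases eq_or_ne (x.1 - y.1) 0 with h0 | h0
  · simp [h0]
  · exact nonpos_of_mul_nonpos_right h (inv_pos.2 (norm_pos_iff.2 h0))

/-- The energy exchange part of the kernel with the factor lost in the bound of the energy. -/
def lossWeight (γ t : ℝ) (β : ℝ × ℝ → ℝ≥0∞) (s : ℝ × ℝ) : ℝ≥0∞ :=
  β s * ENNReal.ofReal ((M.minRatio i j ^ 2 * s.1) ^ (-(γ / 2 * t)))

theorem measurable_lossWeight (γ t : ℝ) {β : ℝ × ℝ → ℝ≥0∞} (hβ : Measurable β) :
    Measurable (M.lossWeight i j γ t β) := by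
  unfold lossWeight
  fun_prop

theorem lintegral_lossWeight (γ t : ℝ) {β : ℝ × ℝ → ℝ≥0∞} (hβ : Measurable β) :
    ENNReal.ofReal (M.minRatio i j ^ (-(3 * t))) * ∫⁻ s, M.lossWeight i j γ t β s *
        ENNReal.ofReal (s.1 ^ (-t) * (1 - s.2) ^ (-t)) ∂unitSquareMeasure
      = ENNReal.ofReal (M.minRatio i j ^ (-((3 + γ) * t))) * ∫⁻ s, β s *
        ENNReal.ofReal (s.1 ^ (-((1 + γ / 2) * t)) * (1 - s.2) ^ (-t)) ∂unitSquareMeasure := by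
  have h0 := M.minRatio_pos i j
  have hm := M.measurable_lossWeight i j γ t hβ
  rw [← lintegral_const_mul _ (by fun_prop), ← lintegral_const_mul _ (by fun_prop)]
  refine lintegral_congr_ae ?_
  filter_upwards [ae_unitSquareMeasure_mem] with s hs
  have h1 := hs.1.1
  have h2 : 0 < 1 - s.2 := sub_pos.2 hs.2.2
  have e1 : M.minRatio i j ^ (-(3 * t)) * ((M.minRatio i j ^ 2 * s.1) ^ (-(γ / 2 * t)) *
      (s.1 ^ (-t) * (1 - s.2) ^ (-t))) = M.minRatio i j ^ (-((3 + γ) * t)) *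
        (s.1 ^ (-((1 + γ / 2) * t)) * (1 - s.2) ^ (-t)) := by
    rw [Real.mul_rpow (by positivity) h1.le, ← Real.rpow_natCast, ← Real.rpow_mul h0.le]
    have a1 : -((3 + γ) * t) = -(3 * t) + ((2 : ℕ) : ℝ) * -(γ / 2 * t) := by push_cast; ring
    have a2 : -((1 + γ / 2) * t) = -(γ / 2 * t) + -t := by ring
    rw [a1, a2, Real.rpow_add h0, Real.rpow_add h1]
    ring
  simp only [lossWeight]
  calc _ = β s * ENNReal.ofReal (M.minRatio i j ^ (-(3 * t)) *
        ((M.minRatio i j ^ 2 * s.1) ^ (-(γ / 2 * t)) * (s.1 ^ (-t) * (1 - s.2) ^ (-t)))) := by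
        rw [ENNReal.ofReal_mul (p := M.minRatio i j ^ (-(3 * t))) (by positivity),
          ENNReal.ofReal_mul (p := (M.minRatio i j ^ 2 * s.1) ^ (-(γ / 2 * t))) (by positivity)]
        ring
    _ = _ := by
        rw [e1, ENNReal.ofReal_mul (by positivity)]
        ring

theorem ofReal_weights_le {a b a' w d k γ s t : ℝ} (h : a' ^ k * w ≤ a ^ ((k + γ) * s) *
      b ^ (k * s + γ) * a' ^ ((k + γ) * t) * d ^ (-(γ / 2 * t)))
    (ha : 0 ≤ a) (hb : 0 ≤ b) (ha' : 0 ≤ a') :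
    ENNReal.ofReal (a' ^ k * w) ≤ ENNReal.ofReal (a ^ ((k + γ) * s)) *
      ENNReal.ofReal (b ^ (k * s + γ)) * ENNReal.ofReal (a' ^ ((k + γ) * t)) *
        ENNReal.ofReal (d ^ (-(γ / 2 * t))) := by
  rw [← ENNReal.ofReal_mul (by positivity), ← ENNReal.ofReal_mul (by positivity),
    ← ENNReal.ofReal_mul (by positivity)]
  exact ENNReal.ofReal_le_ofReal h

/-- The forward part in weighted norms: the brackets and the power of the energy are distributed
over `F`, `G` and `X`. -/
theorem lintegral_weakIntegrand_forward_le {γ k : ℝ} (hγ : 0 ≤ γ) (hk : 0 ≤ k) {p q : ℝ≥0∞}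
    (hpq : p.HolderConjugate q) {F G X : MolState → ℝ≥0∞} (hF : Measurable F) (hG : Measurable G)
    (hX : Measurable X) {h : ℝ → ℝ≥0∞} (hh : Measurable h) (hsupp : ∀ t < 0, h t = 0)
    {β : ℝ × ℝ → ℝ≥0∞} (hβ : Measurable β) :
    ∫⁻ z, M.weakIntegrand i j γ k F G X h β z ∂collMeasure
      ≤ ENNReal.ofReal (M.minRatio i j ^ (-((3 + γ) * q⁻¹.toReal))) * (∫⁻ s, β s *
        ENNReal.ofReal (s.1 ^ (-((1 + γ / 2) * q⁻¹.toReal)) * (1 - s.2) ^ (-q⁻¹.toReal))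
          ∂unitSquareMeasure) * (angMass h *
        (eLpNorm (M.weighted i ((k + γ) * p⁻¹.toReal) F) p stateMeasure *
          eLpNorm (M.weighted j (k * p⁻¹.toReal + γ) G) 1 stateMeasure) *
          eLpNorm (M.weighted i ((k + γ) * q⁻¹.toReal) X) q stateMeasure) := by
  have hm := M.measurable_lossWeight i j γ q⁻¹.toReal hβ
  rw [← M.lintegral_lossWeight i j γ q⁻¹.toReal hβ]
  refine le_trans (lintegral_mono_ae ?_) (M.lintegral_forward_le i j hpq (by fun_prop)
    (by fun_prop) (by fun_prop) hh hsupp hm)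
  filter_upwards [ae_collMeasure_mem] with z hz
  obtain ⟨hx, hy, hr, hR⟩ := hz
  rcases lt_or_ge (cosAngle z.1 z.2.1 z.2.2.1) 0 with hc | hc
  · simp [weakIntegrand, hsupp _ hc]
  have hr' := Ioo_subset_Icc_self hr
  have hR' := Ioo_subset_Icc_self hR
  have ha := M.one_le_bracket i hx
  have hb := M.one_le_bracket j hy
  have ha' := M.one_le_bracket i (M.primed_snd_nonneg i j hx hy hr' hR')
  have hd : 0 < M.minRatio i j ^ 2 * z.2.2.2.1 := mul_pos (pow_pos (M.minRatio_pos i j) 2) hr.1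
  have hw := rpow_mul_rpow_le_weights ha hb ha'
    (div_nonneg (M.energy_nonneg i j hx hy) (M.totalMass_pos i).le) hd hk hγ
    (ENNReal.toReal_nonneg (a := p⁻¹)) (ENNReal.toReal_nonneg (a := q⁻¹))
    (toReal_inv_add_toReal_inv hpq) (M.energy_le_bracket_mul i j hx hy)
    (M.bracket_primed_le i j hx hy hr' hR')
    (M.energy_le_of_inner_nonneg i j hx hy hr' hR' (inner_nonneg_of_cosAngle hc))
  have hw' := ofReal_weights_le hw (by linarith) (by linarith) (by linarith)
  simp only [weakIntegrand, weighted, lossWeight]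
  refine le_trans (mul_le_mul_left (mul_le_mul_left (mul_le_mul_right hw' _) _) _)
    (le_of_eq ?_)
  ring

/-- The backward part in weighted norms: the roles of the two incoming molecules in the
distribution of the weights are interchanged. -/
theorem lintegral_weakIntegrand_backward_le {γ k : ℝ} (hγ : 0 ≤ γ) (hk : 0 ≤ k) {p q : ℝ≥0∞}
    (hpq : p.HolderConjugate q) {F G X : MolState → ℝ≥0∞} (hF : Measurable F) (hG : Measurable G)
    (hX : Measurable X) {h : ℝ → ℝ≥0∞} (hh : Measurable h) (hsupp : ∀ t > 0, h t = 0)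
    {β : ℝ × ℝ → ℝ≥0∞} (hβ : Measurable β) :
    ∫⁻ z, M.weakIntegrand i j γ k F G X h β z ∂collMeasure
      ≤ ENNReal.ofReal (M.minRatio i j ^ (-((3 + γ) * q⁻¹.toReal))) * (∫⁻ s, β s *
        ENNReal.ofReal (s.1 ^ (-((1 + γ / 2) * q⁻¹.toReal)) * (1 - s.2) ^ (-q⁻¹.toReal))
          ∂unitSquareMeasure) * (angMass h *
        (eLpNorm (M.weighted i (k * p⁻¹.toReal + γ) F) 1 stateMeasure *
          eLpNorm (M.weighted j ((k + γ) * p⁻¹.toReal) G) p stateMeasure) *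
          eLpNorm (M.weighted i ((k + γ) * q⁻¹.toReal) X) q stateMeasure) := by
  have hm := M.measurable_lossWeight i j γ q⁻¹.toReal hβ
  rw [← M.lintegral_lossWeight i j γ q⁻¹.toReal hβ]
  refine le_trans (lintegral_mono_ae ?_) (M.lintegral_backward_le i j hpq (by fun_prop)
    (by fun_prop) (by fun_prop) hh hsupp hm)
  filter_upwards [ae_collMeasure_mem] with z hz
  obtain ⟨hx, hy, hr, hR⟩ := hz
  rcases lt_or_ge 0 (cosAngle z.1 z.2.1 z.2.2.1) with hc | hc
  · simp [weakIntegrand, hsupp _ hc]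
  have hr' := Ioo_subset_Icc_self hr
  have hR' := Ioo_subset_Icc_self hR
  have ha := M.one_le_bracket i hx
  have hb := M.one_le_bracket j hy
  have ha' := M.one_le_bracket i (M.primed_snd_nonneg i j hx hy hr' hR')
  have hd : 0 < M.minRatio i j ^ 2 * z.2.2.2.1 := mul_pos (pow_pos (M.minRatio_pos i j) 2) hr.1
  have hw := rpow_mul_rpow_le_weights hb ha ha'
    (div_nonneg (M.energy_nonneg i j hx hy) (M.totalMass_pos i).le) hd hk hγ
    (ENNReal.toReal_nonneg (a := p⁻¹)) (ENNReal.toReal_nonneg (a := q⁻¹))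
    (toReal_inv_add_toReal_inv hpq)
    (mul_comm (M.bracket i z.1) _ ▸ M.energy_le_bracket_mul i j hx hy)
    (mul_comm (M.bracket i z.1) _ ▸ M.bracket_primed_le i j hx hy hr' hR')
    (M.energy_le_of_inner_nonpos i j hx hy hr' hR' (inner_nonpos_of_cosAngle hc))
  have hw' := ofReal_weights_le hw (by linarith) (by linarith) (by linarith)
  simp only [weakIntegrand, weighted, lossWeight]
  refine le_trans (mul_le_mul_left (mul_le_mul_left (mul_le_mul_right hw' _) _) _)
    (le_of_eq ?_)
  ring

end Mixture

/-! ### Measurable majorants -/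

open Classical in
/-- An almost everywhere measurable function has a measurable majorant, valid everywhere, that
agrees with it almost everywhere. Because the bound holds everywhere, it can be composed with the
collision maps without regard to null sets. -/
theorem exists_measurable_majorant {α : Type*} [MeasurableSpace α] {μ : Measure α} {f : α → ℝ≥0∞}
    (hf : AEMeasurable f μ) : ∃ g : α → ℝ≥0∞, Measurable g ∧ (∀ x, f x ≤ g x) ∧ g =ᵐ[μ] f := by
  have h0 : μ (toMeasurable μ {x | f x ≠ hf.mk f x}) = 0 := by
    rw [measure_toMeasurable]
    exact hf.ae_eq_mk
  have hms := measurableSet_toMeasurable μ {x | f x ≠ hf.mk f x}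
  refine ⟨(toMeasurable μ {x | f x ≠ hf.mk f x}).piecewise (fun _ => ∞) (hf.mk f),
    Measurable.piecewise hms measurable_const hf.measurable_mk, fun x => ?_, ?_⟩
  · by_cases hx : x ∈ toMeasurable μ {x | f x ≠ hf.mk f x}
    · simp [hx]
    · rw [piecewise_eq_of_notMem _ _ _ hx]
      have : x ∉ {x | f x ≠ hf.mk f x} := fun h => hx (subset_toMeasurable _ _ h)
      exact (not_not.1 this).le
  · filter_upwards [measure_eq_zero_iff_ae_notMem.1 h0, hf.ae_eq_mk] with x hx hx'
    rw [piecewise_eq_of_notMem _ _ _ hx, hx']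

/-- The part of an angular kernel in a set `S` of cosines has a measurable majorant that vanishes
off `S` and has the same norm. -/
theorem exists_angular_majorant {b : ℝ → ℝ} (hb : ∀ t ∈ Icc (-1 : ℝ) 1, 0 ≤ b t)
    (hbi : IntegrableOn b (Icc (-1) 1)) {S : Set ℝ} (hS : MeasurableSet S) :
    ∃ h : ℝ → ℝ≥0∞, Measurable h ∧ (∀ t ∉ S, h t = 0) ∧
      (∀ t ∈ Icc (-1 : ℝ) 1, t ∈ S → ENNReal.ofReal (b t) ≤ h t) ∧
      angMass h = angNorm (S.indicator b) := by
  obtain ⟨g, hg, hle, heq⟩ := exists_measurable_majorant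
    (hbi.aestronglyMeasurable.aemeasurable.ennreal_ofReal)
  refine ⟨S.indicator g, hg.indicator hS, fun t ht => indicator_of_notMem ht g, ?_, ?_⟩
  · intro t _ ht
    rw [indicator_of_mem ht]
    exact hle t
  · rw [angMass, angNorm]
    congr 1
    refine lintegral_congr_ae ?_
    filter_upwards [heq, ae_restrict_mem measurableSet_Icc] with t ht ht'
    by_cases hS' : t ∈ S
    · rw [indicator_of_mem hS', indicator_of_mem hS', ht, Real.enorm_of_nonneg (hb t ht')]
    · simp [indicator_of_notMem hS']

namespace Mixture

variable {P : ℕ} (M : Mixture P) (i j : Fin P)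

theorem wnorm_eq (p : ℝ≥0∞) (k : ℝ) {f : MolState → ℝ} {F : MolState → ℝ≥0∞}
    (hF : F =ᵐ[stateMeasure] fun x => ‖f x‖ₑ) :
    M.wnorm i p k f = eLpNorm (M.weighted i k F) p stateMeasure := by
  refine eLpNorm_congr_enorm_ae ?_
  filter_upwards [hF, ae_stateMeasure_snd_pos] with x hx hx0
  have := M.one_le_bracket i hx0.le
  rw [enorm_mul, Real.enorm_eq_ofReal_abs |f x|, abs_abs, ← Real.enorm_eq_ofReal_abs, weighted, hx,
    enorm_eq_self, Real.enorm_of_nonneg (show 0 ≤ M.bracket i x ^ k by positivity)]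

theorem rho_eq (γ : ℝ) {bub : ℝ → ℝ → ℝ}
    (hbub : ∀ r ∈ Icc (0 : ℝ) 1, ∀ R ∈ Icc (0 : ℝ) 1, 0 ≤ bub r R) (q : ℝ≥0∞)
    {β : ℝ × ℝ → ℝ≥0∞}
    (hβ : β =ᵐ[unitSquareMeasure] fun s => ENNReal.ofReal (bub s.1 s.2 * M.dens i j s.1 s.2)) :
    M.rho i j γ bub q = ∫⁻ s, β s *
        ENNReal.ofReal (s.1 ^ (-((1 + γ / 2) * q⁻¹.toReal)) * (1 - s.2) ^ (-q⁻¹.toReal))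
          ∂unitSquareMeasure := by
  refine lintegral_congr_ae ?_
  filter_upwards [hβ, ae_unitSquareMeasure_mem] with s hs hs'
  have h1 := Ioo_subset_Icc_self hs'.1
  have h2 := Ioo_subset_Icc_self hs'.2
  rw [hs, ← ENNReal.ofReal_mul (mul_nonneg (hbub _ h1 _ h2) (M.dens_nonneg i j h1 h2))]
  congr 1
  ring

end Mixture

/-! ### The weak form of the gain operator -/

namespace Mixture

variable {P : ℕ} {M : Mixture P} {i j : Fin P} {γ : ℝ} {b : ℝ → ℝ} {bub : ℝ → ℝ → ℝ}
  {B : MolState → MolState → CollParam → ℝ}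

theorem inner_dir_mem_Icc (σ σ' : Dir) : inner ℝ (σ : Vel) (σ' : Vel) ∈ Icc (-1 : ℝ) 1 := by
  have := abs_real_inner_le_norm (σ : Vel) (σ' : Vel)
  simp only [norm_eq_of_mem_sphere, mul_one] at this
  exact abs_le.1 this

/-- By microreversibility, the collision kernel is bounded by the energy exchange part at the
parameters of the incoming pair. -/
theorem IsCollisionKernel.ae_le (hB : M.IsCollisionKernel i j γ b bub B) :
    ∀ᵐ y ∂centerCollMeasure, 0 ≤ B (M.collVar i j y).1 (M.collVar i j y).2.1 y.2.2 ∧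
      B (M.collVar i j y).1 (M.collVar i j y).2.1 y.2.2
        ≤ b (inner ℝ (y.2.2.1 : Vel) (y.2.1.1 : Vel)) * bub y.2.1.2.1 y.2.1.2.2
          * (y.1.2 / M.totalMass) ^ (γ / 2) := by
  have h1 := M.ae_collVar i j hB.nonneg
  have h2 := M.ae_collVar i j hB.microreversible
  have h3 := measurePreserving_swap_center.quasiMeasurePreserving.ae
    (M.ae_collVar i j hB.upper_bound)
  filter_upwards [h1, h2, h3, ae_isRegularColl] with y h1 h2 h3 hreg
  refine ⟨h1, ?_⟩
  obtain ⟨n, c', c⟩ := y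
  obtain ⟨hE, ⟨hr', hR'⟩, ⟨hr, hR⟩⟩ := hreg
  simp only [collVar] at *
  rw [h2 c'.1 (M.unit_relVel_collState i j hE hR'.1).symm,
    M.primed_collState i j hE.le hR'.1.le, M.primedStar_collState i j hE.le hR'.1.le,
    M.primedr_collState i j hE hR'.2, M.primedR_collState i j hE hR'.1.le]
  rw [M.unit_relVel_collState i j hE hR.1, M.energy_collState i j hE.le hR.1.le] at h3
  exact h3

/-- The weak form of the gain operator is bounded by the integral of `weakIntegrand`. -/
theorem IsCollisionKernel.lintegral_gainIntegrand_le (hB : M.IsCollisionKernel i j γ b bub B)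
    (k : ℝ) {f g χ : MolState → ℝ} {F G X : MolState → ℝ≥0∞} (hF : Measurable F)
    (hG : Measurable G) (hX : Measurable X) (hf : ∀ x, ‖f x‖ₑ ≤ F x) (hg : ∀ x, ‖g x‖ₑ ≤ G x)
    (hχ : ∀ x, ‖χ x‖ₑ ≤ X x) {h : ℝ → ℝ≥0∞} (hh : Measurable h)
    (hb : ∀ t ∈ Icc (-1 : ℝ) 1, ENNReal.ofReal (b t) ≤ h t) {β : ℝ × ℝ → ℝ≥0∞} (hβm : Measurable β)
    (hβ : ∀ s, ENNReal.ofReal (bub s.1 s.2 * M.dens i j s.1 s.2) ≤ β s) :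
    ∫⁻ z, ‖M.gainIntegrand i j B f g z.1 z.2 * χ z.1 * M.bracket i z.1 ^ k‖ₑ ∂collMeasure
      ≤ ∫⁻ z, M.weakIntegrand i j γ k F G X h β z ∂collMeasure := by
  refine M.lintegral_collMeasure_le_of_swap i j
    (M.measurable_weakIntegrand i j γ k hF hG hX hh hβm) ?_
  filter_upwards [hB.ae_le, ae_isRegularColl] with y hy hreg
  obtain ⟨n, c', c⟩ := y
  have hw := M.weight_mul_collJac i j hreg
  obtain ⟨hE, ⟨hr', hR'⟩, ⟨hr, hR⟩⟩ := hreg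
  simp only [collVar] at *
  obtain ⟨hB0, hB1⟩ := hy
  have hJ := M.collJac_pos i j hE hR
  have hJ' := M.collJac_pos i j hE hR'
  have hd' := M.dens_nonneg i j (Ioo_subset_Icc_self hr') (Ioo_subset_Icc_self hR')
  have hbub := hB.exchange_nonneg _ (Ioo_subset_Icc_self hr') _ (Ioo_subset_Icc_self hR')
  have hcos := inner_dir_mem_Icc c.1 c'.1
  have hb0 := hB.angular_nonneg _ hcos
  have hI' : 0 ≤ (M.collState i j n c').1.2 :=
    mul_nonneg (mul_nonneg hr'.1.le (sub_nonneg.2 hR'.2.le)) hE.le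
  have hbr := M.one_le_bracket i hI'
  have hbr0 : 0 ≤ M.bracket i (M.collState i j n c').1 ^ k := by positivity
  have hEm : 0 ≤ (n.2 / M.totalMass) ^ (γ / 2) :=
    Real.rpow_nonneg (div_nonneg hE.le (M.totalMass_pos i).le) _
  simp only [collDensity, weakIntegrand, gainIntegrand, cosAngle]
  rw [M.primed_collState i j hE.le hR'.1.le, M.primedStar_collState i j hE.le hR'.1.le,
    M.primed_collState i j hE.le hR.1.le, M.unit_relVel_collState i j hE hR.1,
    M.energy_collState i j hE.le hR.1.le]
  set x := (M.collState i j n c').1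
  set y := (M.collState i j n c').2
  set x' := (M.collState i j n c).1
  set y' := (M.collState i j n c).2
  set W := (x.2 / x'.2) ^ M.alpha i * (y.2 / y'.2) ^ M.alpha j * M.dens i j c.2.1 c.2.2 with hW
  have hW0 : 0 ≤ W := nonneg_of_mul_nonneg_left (hw ▸ mul_nonneg hd' hJ.le) hJ'
  have e1 : f x' * g y' * (x.2 / x'.2) ^ M.alpha i * (y.2 / y'.2) ^ M.alpha j * B x y c
      * M.dens i j c.2.1 c.2.2 * χ x * M.bracket i x ^ k
      = f x' * (g y' * (χ x * (M.bracket i x ^ k * (W * B x y c)))) := by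
    rw [hW]; ring
  rw [e1]
  simp only [enorm_mul]
  rw [Real.enorm_of_nonneg hbr0, Real.enorm_of_nonneg hW0, Real.enorm_of_nonneg hB0]
  have e2 : ENNReal.ofReal (M.collJac i j n.2 c') * (ENNReal.ofReal W * ENNReal.ofReal (B x y c))
      ≤ ENNReal.ofReal (M.collJac i j n.2 c) * (ENNReal.ofReal ((n.2 / M.totalMass) ^ (γ / 2)) *
        (h (inner ℝ (c.1 : Vel) (c'.1 : Vel)) * β c'.2)) := by
    calc _ = ENNReal.ofReal (M.dens i j c'.2.1 c'.2.2 * M.collJac i j n.2 c * B x y c) := by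
          rw [← ENNReal.ofReal_mul hW0, ← ENNReal.ofReal_mul hJ'.le, ← hw]
          congr 1
          ring
      _ ≤ ENNReal.ofReal (M.collJac i j n.2 c * ((n.2 / M.totalMass) ^ (γ / 2) *
          (b (inner ℝ (c.1 : Vel) (c'.1 : Vel)) *
            (bub c'.2.1 c'.2.2 * M.dens i j c'.2.1 c'.2.2)))) := by
          refine ENNReal.ofReal_le_ofReal ?_
          refine (mul_le_mul_of_nonneg_left hB1 (mul_nonneg hd' hJ.le)).trans (le_of_eq ?_)
          ring
      _ ≤ _ := by
          rw [ENNReal.ofReal_mul hJ.le, ENNReal.ofReal_mul hEm, ENNReal.ofReal_mul hb0]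
          gcongr
          · exact hb _ hcos
          · exact hβ _
  rw [ENNReal.ofReal_mul hbr0]
  calc _ = ‖f x'‖ₑ * ‖g y'‖ₑ * ‖χ x‖ₑ * ENNReal.ofReal (M.bracket i x ^ k) *
        (ENNReal.ofReal (M.collJac i j n.2 c') *
          (ENNReal.ofReal W * ENNReal.ofReal (B x y c))) := by ring
    _ ≤ F x' * G y' * X x * ENNReal.ofReal (M.bracket i x ^ k) *
        (ENNReal.ofReal (M.collJac i j n.2 c) * (ENNReal.ofReal ((n.2 / M.totalMass) ^ (γ / 2)) *
        (h (inner ℝ (c.1 : Vel) (c'.1 : Vel)) * β c'.2))) := by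
        gcongr
        · exact hf _
        · exact hg _
        · exact hχ _
    _ = _ := by ring

/-- The weak form of the gain operator, with absolute values, is bounded by `weakBound`. -/
theorem IsCollisionKernel.lintegral_gainIntegrand_le_weakBound
    (hB : M.IsCollisionKernel i j γ b bub B) {p q : ℝ≥0∞} (hpq : p.HolderConjugate q)
    {k : ℝ} (hk : 0 ≤ k) {f g χ : MolState → ℝ}
    (hf : AEMeasurable f stateMeasure) (hg : AEMeasurable g stateMeasure)
    (hχ : AEMeasurable χ stateMeasure) :
    ∫⁻ z, ‖M.gainIntegrand i j B f g z.1 z.2 * χ z.1 * M.bracket i z.1 ^ k‖ₑ ∂collMeasure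
      ≤ M.weakBound i j γ b bub p q k f g χ := by
  have hγ := hB.rate_mem.1
  obtain ⟨F, hF, hfF, hFf⟩ := exists_measurable_majorant hf.enorm
  obtain ⟨G, hG, hgG, hGg⟩ := exists_measurable_majorant hg.enorm
  obtain ⟨X, hX, hχX, hXχ⟩ := exists_measurable_majorant hχ.enorm
  obtain ⟨β, hβ, hβle, hβeq⟩ := exists_measurable_majorant
    hB.exchange_integrable.aestronglyMeasurable.aemeasurable.ennreal_ofReal
  obtain ⟨h₁, hh₁, hs₁, hb₁, hm₁⟩ := exists_angular_majorant hB.angular_nonneg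
    hB.angular_integrable (measurableSet_Ici (a := (0 : ℝ)))
  obtain ⟨h₂, hh₂, hs₂, hb₂, hm₂⟩ := exists_angular_majorant hB.angular_nonneg
    hB.angular_integrable (measurableSet_Iic (a := (0 : ℝ)))
  have hb : ∀ t ∈ Icc (-1 : ℝ) 1, ENNReal.ofReal (b t) ≤ h₁ t + h₂ t := by
    intro t ht
    rcases le_total 0 t with h0 | h0
    · exact (hb₁ t ht h0).trans le_self_add
    · exact (hb₂ t ht h0).trans le_add_self
  -- Splitting the majorant rather than `b` counts `t = 0` twice, which does no harm to the bound.
  have hsplit : ∀ z, M.weakIntegrand i j γ k F G X (fun t => h₁ t + h₂ t) β z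
      = M.weakIntegrand i j γ k F G X h₁ β z + M.weakIntegrand i j γ k F G X h₂ β z := by
    intro z
    simp only [weakIntegrand]
    ring
  have hfw := M.lintegral_weakIntegrand_forward_le i j hγ hk hpq hF hG hX hh₁
    (fun t ht => hs₁ t (not_le.2 ht)) hβ
  have hbw := M.lintegral_weakIntegrand_backward_le i j hγ hk hpq hF hG hX hh₂
    (fun t ht => hs₂ t (not_le.2 ht)) hβ
  refine (hB.lintegral_gainIntegrand_le k hF hG hX hfF hgG hχX (h := fun t => h₁ t + h₂ t)
    (hh₁.add hh₂) hb hβ hβle).trans ?_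
  simp only [hsplit]
  rw [lintegral_add_left (M.measurable_weakIntegrand i j γ k hF hG hX hh₁ hβ)]
  rw [← M.rho_eq i j γ hB.exchange_nonneg q hβeq, ← M.wnorm_eq _ _ _ hFf, ← M.wnorm_eq _ _ _ hGg,
    ← M.wnorm_eq _ _ _ hXχ, hm₁] at hfw
  rw [← M.rho_eq i j γ hB.exchange_nonneg q hβeq, ← M.wnorm_eq _ _ _ hFf, ← M.wnorm_eq _ _ _ hGg,
    ← M.wnorm_eq _ _ _ hXχ, hm₂] at hbw
  have hfwd : (Ici (0 : ℝ)).indicator b = fwd b := rfl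
  have hbwd : (Iic (0 : ℝ)).indicator b = bwd b := rfl
  rw [hfwd] at hfw
  rw [hbwd] at hbw
  have hs := M.minRatio_pos i j
  have ht : 0 ≤ q⁻¹.toReal := ENNReal.toReal_nonneg
  -- The two powers of `2` in the bound are at least `1`, and are not needed.
  have hc1 : 1 ≤ ENNReal.ofReal ((2 : ℝ) ^ (q⁻¹.toReal / 2)) :=
    ENNReal.one_le_ofReal.2 (Real.one_le_rpow (by norm_num) (by positivity))
  have hc2 : ENNReal.ofReal (M.minRatio i j ^ (-((3 + γ) * q⁻¹.toReal))) * M.rho i j γ bub q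
      ≤ M.cConst i j γ bub q := by
    rw [cConst]
    gcongr
    exact le_mul_of_one_le_left (by positivity)
      (Real.one_le_rpow (by norm_num) (by positivity))
  have hc := hc2.trans (le_mul_of_one_le_left zero_le hc1)
  refine (add_le_add hfw hbw).trans ?_
  rw [weakBound, ← mul_add, ← add_mul, ← mul_assoc]
  simp only [← mul_assoc (angNorm _)]
  exact mul_le_mul_left (mul_le_mul_left hc _) _

theorem IsCollisionKernel.aestronglyMeasurable_gainIntegrand
    (hB : M.IsCollisionKernel i j γ b bub B) (k : ℝ) {f g χ : MolState → ℝ}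
    (hf : AEMeasurable f stateMeasure) (hg : AEMeasurable g stateMeasure)
    (hχ : AEMeasurable χ stateMeasure) :
    AEStronglyMeasurable
      (fun z : MolState × MolState × CollParam =>
        M.gainIntegrand i j B f g z.1 z.2 * χ z.1 * M.bracket i z.1 ^ k) collMeasure := by
  refine AEMeasurable.aestronglyMeasurable ?_
  have hq := M.quasiMeasurePreserving_primed i j
  have h1 : AEMeasurable (fun z : MolState × MolState × CollParam =>
      f (M.primed i j z.1 z.2.1 z.2.2)) collMeasure :=
    hf.comp_quasiMeasurePreserving (Measure.quasiMeasurePreserving_fst.comp hq)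
  have h2 : AEMeasurable (fun z : MolState × MolState × CollParam =>
      g (M.primedStar i j z.1 z.2.1 z.2.2)) collMeasure :=
    hg.comp_quasiMeasurePreserving (Measure.quasiMeasurePreserving_snd.comp hq)
  have h3 : AEMeasurable (fun z : MolState × MolState × CollParam => χ z.1) collMeasure :=
    hχ.comp_quasiMeasurePreserving Measure.quasiMeasurePreserving_fst
  have h4 : AEMeasurable (fun z : MolState × MolState × CollParam => B z.1 z.2.1 z.2.2)
      collMeasure := hB.measurable
  have h5 : Measurable (fun z : MolState × MolState × CollParam =>
      (z.1.2 / (M.primed i j z.1 z.2.1 z.2.2).2) ^ M.alpha i) := by fun_prop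
  have h6 : Measurable (fun z : MolState × MolState × CollParam =>
      (z.2.1.2 / (M.primedStar i j z.1 z.2.1 z.2.2).2) ^ M.alpha j) := by fun_prop
  have h7 : Measurable (fun z : MolState × MolState × CollParam =>
      M.dens i j z.2.2.2.1 z.2.2.2.2) := by unfold dens; fun_prop
  have h8 : Measurable (fun z : MolState × MolState × CollParam => M.bracket i z.1 ^ k) := by
    fun_prop
  exact ((((((h1.mul h2).mul h5.aemeasurable).mul h6.aemeasurable).mul h4).mul
    h7.aemeasurable).mul h3).mul h8.aemeasurable

end Mixture

theorem mainTheorem3 {P : ℕ} (M : Mixture P) (i j : Fin P) (γ : ℝ) (b : ℝ → ℝ)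
    (bub : ℝ → ℝ → ℝ) (B : MolState → MolState → CollParam → ℝ)
    (hB : M.IsCollisionKernel i j γ b bub B)
    (p q : ℝ≥0∞) (hpq : p.HolderConjugate q) (hρ : M.rho i j γ bub q < ∞)
    (k : ℝ) (hk : 0 ≤ k) (f g χ : MolState → ℝ)
    (hf : AEMeasurable f stateMeasure) (hg : AEMeasurable g stateMeasure)
    (hχ : AEMeasurable χ stateMeasure)
    (hfin : M.weakBound i j γ b bub p q k f g χ < ∞) :
    (∀ᵐ x ∂stateMeasure, χ x ≠ 0 →
      Integrable (M.gainIntegrand i j B f g x) (stateMeasure.prod paramMeasure)) ∧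
    Integrable (fun x => M.gain i j B f g x * χ x * M.bracket i x ^ k) stateMeasure ∧
    ∫ x, M.gain i j B f g x * χ x * M.bracket i x ^ k ∂stateMeasure
      ≤ (M.weakBound i j γ b bub p q k f g χ).toReal := by
  have hle := hB.lintegral_gainIntegrand_le_weakBound hpq hk hf hg hχ
  have hint : Integrable (fun z : MolState × MolState × CollParam =>
      M.gainIntegrand i j B f g z.1 z.2 * χ z.1 * M.bracket i z.1 ^ k)
      (stateMeasure.prod (stateMeasure.prod paramMeasure)) :=
    ⟨hB.aestronglyMeasurable_gainIntegrand k hf hg hχ, hle.trans_lt hfin⟩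
  have hgain : ∀ x, ∫ w, M.gainIntegrand i j B f g x w * χ x * M.bracket i x ^ k
      ∂(stateMeasure.prod paramMeasure) = M.gain i j B f g x * χ x * M.bracket i x ^ k := by
    intro x
    rw [integral_mul_const, integral_mul_const]
    rfl
  refine ⟨?_, ?_, ?_⟩
  · filter_upwards [hint.prod_right_ae, ae_stateMeasure_snd_pos] with x hx hx0 hχx
    have hbr := M.one_le_bracket i hx0.le
    have hne : χ x * M.bracket i x ^ k ≠ 0 :=
      mul_ne_zero hχx (Real.rpow_pos_of_pos (by linarith) k).ne'
    simp only [mul_assoc] at hx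
    exact (integrable_mul_const_iff (IsUnit.mk0 _ hne) _).1 hx
  · exact hint.integral_prod_left.congr (Filter.Eventually.of_forall hgain)
  · calc ∫ x, M.gain i j B f g x * χ x * M.bracket i x ^ k ∂stateMeasure
        = ∫ z, M.gainIntegrand i j B f g z.1 z.2 * χ z.1 * M.bracket i z.1 ^ k
          ∂(stateMeasure.prod (stateMeasure.prod paramMeasure)) := by
          rw [integral_prod _ hint]
          exact (integral_congr_ae (Filter.Eventually.of_forall hgain)).symm
      _ ≤ ‖∫ z, M.gainIntegrand i j B f g z.1 z.2 * χ z.1 * M.bracket i z.1 ^ k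
          ∂(stateMeasure.prod (stateMeasure.prod paramMeasure))‖ := le_abs_self _
      _ ≤ (∫⁻ z, ‖M.gainIntegrand i j B f g z.1 z.2 * χ z.1 * M.bracket i z.1 ^ k‖ₑ
          ∂collMeasure).toReal := by
          rw [← toReal_enorm]
          exact ENNReal.toReal_mono (hle.trans_lt hfin).ne (enorm_integral_le_lintegral_enorm _)
      _ ≤ _ := ENNReal.toReal_mono hfin.ne hle

end
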